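/- Write $M_n=M_n(\mathbb C)$. A linear map $\phi:M_n\to M_n$ is \emph{$q$-positive} if it has no negative eigenvalues and $\phi(I+t\phi)^{-1}$ is completely positive for all $t\ge 0$. For $q$-positive maps $\phi,\psi$ on $M_n$, $\psi$ is a \emph{$q$-subordinate} of $\phi$ if $\phi(I+t\phi)^{-1}-\psi(I+t\psi)^{-1}$ is completely positive for all $t\ge 0$. A $q$-positive map $\phi$ is \emph{$q$-pure} if its set of $q$-subordinates is exactly $\{\phi(I+s\phi)^{-1}: s\ge 0\}\cup\{0\}$. A linear map $\phi$ on $M_n$ is \emph{conjugate} to a linear map $\psi$ on $M_n$ if there is a unitary $U\in M_n$ with $\phi(A)=U^*\psi(UAU^*)U$ for all $A\in M_n$. Theorem. A unital linear map $\phi:M_2(\mathbb C)\to M_2(\mathbb C)$ is $q$-pure if and only if it satisfies one of the following: (i) $\phi(A)=\rho(A)I$ for all $A\in M_2(\mathbb C)$, where $\rho\in M_2(\mathbb C)^*$ is a faithful state; (ii) for some $\lambda\in\mathbb R$, $\phi$ is conjugate to the Schur map $\psi$ defined by $$\psi(A)=\begin{pmatrix} a_{11} & \dfrac{a_{12}}{1+i\lambda}\\[2mm]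 \dfrac{a_{21}}{1-i\lambda} & a_{22}\end{pmatrix}\qquad\text{for all } A=(a_{ij})\in M_2(\mathbb C).$$ In particular, every unital $q$-pure map on $M_2(\mathbb C)$ either has rank one or is invertible. -/

import Mathlib

open scoped ComplexOrder

noncomputable section

namespace QPos

/-- `M_n(ℂ)`. -/
abbrev Mat (n : ℕ) : Type := Matrix (Fin n) (Fin n) ℂ

/-- Linear maps `M_n(ℂ) → M_n(ℂ)`, with composition as multiplication. -/
abbrev Map (n : ℕ) : Type := Module.End ℂ (Mat n)

variable {n : ℕ}

/-- Complete positivity: for every `k`, applying `φ` entrywise to a `k × k` block matrix over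
`M_n(ℂ)` that is positive as a matrix of size `k * n` gives a positive matrix.
(`Matrix.comp` forgets the block structure.) -/
def IsCP (φ : Map n) : Prop :=
  ∀ (k : ℕ) (A : Matrix (Fin k) (Fin k) (Mat n)),
    (Matrix.comp (Fin k) (Fin k) (Fin n) (Fin n) ℂ A).PosSemidef →
      (Matrix.comp (Fin k) (Fin k) (Fin n) (Fin n) ℂ (A.map φ)).PosSemidef

/-- `φ` has no negative (real) eigenvalues. -/
def NoNegEigenvalue (φ : Map n) : Prop :=
  ∀ r : ℝ, r < 0 → ¬ Module.End.HasEigenvalue φ (r : ℂ)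

/-- The map `φ (I + t φ)⁻¹`. For `t ≥ 0` and `φ` without negative eigenvalues, `I + t φ` is
invertible and `Ring.inverse` is its inverse. -/
def resolvent (φ : Map n) (t : ℝ) : Map n :=
  φ * Ring.inverse (1 + (t : ℂ) • φ)

/-- `φ` is `q`-positive. -/
def IsQPositive (φ : Map n) : Prop :=
  NoNegEigenvalue φ ∧ ∀ t : ℝ, 0 ≤ t → IsCP (resolvent φ t)

/-- `φ ≥_q ψ`: both maps are `q`-positive and `φ` `q`-dominates `ψ`,
that is, `ψ` is a `q`-subordinate of `φ`. -/
def QDominates (φ ψ : Map n) : Prop :=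
  IsQPositive φ ∧ IsQPositive ψ ∧
    ∀ t : ℝ, 0 ≤ t → IsCP (resolvent φ t - resolvent ψ t)

/-- `φ` is `q`-pure: it is `q`-positive and its set of `q`-subordinates is
`{φ (I + s φ)⁻¹ : s ≥ 0} ∪ {0}`. -/
def IsQPure (φ : Map n) : Prop :=
  IsQPositive φ ∧
    {ψ : Map n | QDominates φ ψ} = {ψ : Map n | ∃ s : ℝ, 0 ≤ s ∧ ψ = resolvent φ s} ∪ {0}

/-- A state on `M_n(ℂ)`: a positive linear functional with value `1` at the identity. -/
def IsState (ρ : Mat n →ₗ[ℂ] ℂ) : Prop :=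
  (∀ A : Mat n, A.PosSemidef → 0 ≤ ρ A) ∧ ρ 1 = 1

/-- A faithful state: no nonzero positive matrix is annihilated. -/
def IsFaithfulState (ρ : Mat n →ₗ[ℂ] ℂ) : Prop :=
  IsState ρ ∧ ∀ A : Mat n, A.PosSemidef → ρ A = 0 → A = 0

/-- The Schur map `A ↦ M • A` (entrywise product). -/
def schurMap (M : Mat n) : Map n where
  toFun A := Matrix.hadamard M A
  map_add' A B := Matrix.hadamard_add M A B
  map_smul' c A := Matrix.hadamard_smul M A c

/-- `ψ` is conjugate to `φ`: for some unitary `U`, `ψ(A) = U* φ(U A U*) U` for all `A`. -/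
def IsConjugateTo (ψ φ : Map n) : Prop :=
  ∃ U ∈ Matrix.unitaryGroup (Fin n) ℂ,
    ∀ A : Mat n, ψ A = star U * φ (U * A * star U) * U

end QPos

end

/-!
If `φ` is unital and `q`-positive, then `t φ (1 + t φ)⁻¹` stays bounded as `t → ∞`, and its cluster
points `L` are completely positive idempotents with the range and the kernel of `φ`. The same holds
for every `q`-subordinate of `φ`.

On `M₂`, let `φ` be `q`-pure and unital. Either all values of `φ` are scalar, or after a unitary
conjugation some value is a nonscalar diagonal matrix. In the second case `L` fixes all diagonal
matrices, and complete positivity leaves two candidates for `L`: the identity, in which case `φ` is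
invertible, and the projection onto the diagonal, in which case `φ` is the transition matrix of a
two-state Markov chain. Such a chain of rank two has a `q`-subordinate supported on a single matrix
entry, so it is not `q`-pure.

For invertible maps one compares inverses: `ψ` is a `q`-subordinate of `φ` if and only if
`ψ⁻¹ - φ⁻¹` is completely positive. As `t² φ (1 + t φ)⁻¹ - t → -φ⁻¹`, the map `-φ⁻¹` is a Lindblad
generator, that is, completely positive up to a Lyapunov map `A ↦ Y A + A Y*`. Cancelling the
completely positive part gives a `q`-subordinate, so purity forces `φ⁻¹` to be a Lyapunov map, where
`Y + Y* = 1` since `φ` is unital. Diagonalizing `Y` gives the Schur maps. Conversely, if `φ⁻¹` is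
a Lyapunov map and `ψ` is an invertible `q`-subordinate, then both `ψ⁻¹ - φ⁻¹` and the dissipative
part of `-ψ⁻¹` are completely positive, so that `ψ⁻¹ - φ⁻¹` is a multiple of the identity.
-/

noncomputable section

namespace QPos

open Matrix Filter Topology

variable {n : ℕ}

/-! ### Positive semidefinite matrices -/

section PosSemidef

variable {ι : Type*}

open scoped MatrixOrder Matrix.Norms.L2Operator in
lemma isClosed_setOf_posSemidef [Finite ι] : IsClosed {M : Matrix ι ι ℂ | M.PosSemidef} := by
  classical
  have := Fintype.ofFinite ι
  simpa only [nonneg_iff_posSemidef] using CStarAlgebra.isClosed_nonneg (A := Matrix ι ι ℂ)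

open scoped MatrixOrder Matrix.Norms.L2Operator in
lemma exists_pos_smul_one_sub_posSemidef [Finite ι] [DecidableEq ι] {M : Matrix ι ι ℂ}
    (hM : M.IsHermitian) : ∃ c : ℝ, 0 < c ∧ ((c : ℂ) • (1 : Matrix ι ι ℂ) - M).PosSemidef := by
  have := Fintype.ofFinite ι
  refine ⟨‖M‖ + 1, by positivity, ?_⟩
  have hM_le : M ≤ algebraMap ℝ (Matrix ι ι ℂ) ‖M‖ := hM.isSelfAdjoint.le_algebraMap_norm_self
  rw [← le_iff, Complex.coe_smul, ← Algebra.algebraMap_eq_smul_one, map_add, map_one]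
  exact hM_le.trans (le_add_of_nonneg_right PosSemidef.one.nonneg)

open scoped MatrixOrder in
lemma eq_zero_of_posSemidef_of_neg_posSemidef [Finite ι] {M : Matrix ι ι ℂ}
    (h : M.PosSemidef) (h' : (-M).PosSemidef) : M = 0 :=
  have := Fintype.ofFinite ι
  le_antisymm (neg_nonneg.mp h'.nonneg) h.nonneg

lemma posSemidef_of_forall_dotProduct_mulVec_nonneg [Fintype ι] {M : Matrix ι ι ℂ}
    (h : ∀ x : ι → ℂ, 0 ≤ star x ⬝ᵥ (M *ᵥ x)) : M.PosSemidef := by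
  classical
  rw [← isPositive_toEuclideanLin_iff, LinearMap.isPositive_iff_complex]
  intro x
  have h_inner : inner ℂ (toEuclideanLin M x) x = star (star x.ofLp ⬝ᵥ (M *ᵥ x.ofLp)) := by
    rw [EuclideanSpace.inner_eq_star_dotProduct, toLpLin_apply, star_dotProduct, star_star,
      dotProduct_comm]
  obtain ⟨h_re, h_im⟩ := Complex.nonneg_iff.mp (h x.ofLp)
  rw [h_inner]
  exact ⟨Complex.ext (by simp) (by simp [← h_im]), by simpa using h_re⟩

lemma norm_sq_apply_le_of_posSemidef {M : Matrix ι ι ℂ} (h : M.PosSemidef) (i j : ι) :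
    ‖M i j‖ ^ 2 ≤ (M i i).re * (M j j).re := by
  have h_det := (h.submatrix ![i, j]).det_nonneg
  simp only [det_fin_two, submatrix_apply, cons_val_zero, cons_val_one] at h_det
  have hi := Complex.nonneg_iff.mp (h.diag_nonneg (i := i))
  have hj := Complex.nonneg_iff.mp (h.diag_nonneg (i := j))
  rw [← h.isHermitian.apply j i, RCLike.star_def, Complex.mul_conj, Complex.nonneg_iff] at h_det
  simp only [Complex.sub_re, Complex.mul_re, ← hi.2, ← hj.2, Complex.ofReal_re,
    Complex.normSq_eq_norm_sq] at h_det
  linarith [h_det.1]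

lemma apply_eq_zero_of_posSemidef_of_diag_left {M : Matrix ι ι ℂ} (h : M.PosSemidef) {i : ι}
    (hi : M i i = 0) (j : ι) : M i j = 0 := by
  simpa [hi] using norm_sq_apply_le_of_posSemidef h i j

lemma apply_eq_zero_of_posSemidef_of_diag_right {M : Matrix ι ι ℂ} (h : M.PosSemidef) {j : ι}
    (hj : M j j = 0) (i : ι) : M i j = 0 := by
  simpa [hj] using norm_sq_apply_le_of_posSemidef h i j

/- Testing `Z X + X Zᴴ ≥ 0` against an eigenvector `v` of `X` with eigenvalue `μ` gives
`0 ≤ μ ⟪v, (Z + Zᴴ) v⟫`. -/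
lemma posSemidef_of_mul_add_mul_conjTranspose [Fintype ι] {X Z : Matrix ι ι ℂ}
    (hX : X.IsHermitian) (hZ : (Z + Zᴴ).PosDef) (h : (Z * X + X * Zᴴ).PosSemidef) :
    X.PosSemidef := by
  classical
  rw [hX.posSemidef_iff_eigenvalues_nonneg]
  intro i
  set v : ι → ℂ := (hX.eigenvectorBasis i).ofLp with hv
  set μ : ℂ := (hX.eigenvalues i : ℂ) with hμ
  have hv_ne : v ≠ 0 := fun h0 =>
    hX.eigenvectorBasis.orthonormal.ne_zero i (WithLp.ofLp_injective 2 h0)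
  have hXv : X *ᵥ v = μ • v := by
    rw [hv, hX.mulVec_eigenvectorBasis i, hμ, Complex.coe_smul]
  have hvX : star v ᵥ* X = μ • star v := by
    have := congrArg star hXv
    rwa [star_mulVec, hX.eq, star_smul, hμ, RCLike.star_def, Complex.conj_ofReal] at this
  have h_quad : star v ⬝ᵥ ((Z * X + X * Zᴴ) *ᵥ v) = μ * (star v ⬝ᵥ ((Z + Zᴴ) *ᵥ v)) := by
    rw [add_mulVec, ← mulVec_mulVec, ← mulVec_mulVec, hXv, mulVec_smul, dotProduct_add,
      dotProduct_smul, dotProduct_mulVec _ X, hvX, smul_dotProduct, add_mulVec, dotProduct_add,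
      smul_eq_mul, smul_eq_mul, mul_add]
  have h_nonneg := (Complex.nonneg_iff.mp (h_quad ▸ h.dotProduct_mulVec_nonneg v)).1
  rw [hμ, Complex.re_ofReal_mul] at h_nonneg
  exact nonneg_of_mul_nonneg_left h_nonneg
    (Complex.pos_iff.mp (hZ.dotProduct_mulVec_pos hv_ne)).1

end PosSemidef

/-! ### Choi matrices and complete positivity -/

/-- The Choi matrix of a linear map on `M_n(ℂ)`, whose entry at `((i, k), (j, l))` is the
`(k, l)` entry of `φ (e_i e_jᵀ)`; as a linear equivalence, so that maps can be defined by their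
Choi matrix. -/
def choi : Map n ≃ₗ[ℂ] Matrix (Fin n × Fin n) (Fin n × Fin n) ℂ :=
  ((stdBasis ℂ (Fin n) (Fin n)).constr ℂ).symm ≪≫ₗ LinearEquiv.curry ℂ _ (Fin n) (Fin n) ≪≫ₗ
    compLinearEquiv (Fin n) (Fin n) (Fin n) (Fin n) ℂ ℂ

lemma choi_apply (φ : Map n) (x y : Fin n × Fin n) :
    choi φ x y = φ (single x.1 y.1 1) x.2 y.2 := by
  rw [← stdBasis_eq_single]
  rfl

lemma map_apply_eq_sum_choi (φ : Map n) (A : Mat n) (k l : Fin n) :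
    φ A k l = ∑ i, ∑ j, A i j * choi φ (i, k) (j, l) := by
  have h_single (i j : Fin n) : φ (single i j (A i j)) = A i j • φ (single i j 1) := by
    rw [← map_smul, smul_single, smul_eq_mul, mul_one]
  conv_lhs => rw [matrix_eq_sum_single A]
  simp only [map_sum, h_single, Matrix.sum_apply, Matrix.smul_apply, smul_eq_mul, choi_apply]

lemma star_vec_one : star (vec (1 : Mat n)) = vec 1 := by
  ext x
  simp [vec, one_apply, apply_ite]

lemma choi_one : choi (1 : Map n) = vecMulVec (vec 1) (vec 1) := by
  ext x y
  rw [choi_apply, Module.End.one_apply, single_apply, vecMulVec_apply, vec, vec, one_apply,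
    one_apply]
  by_cases hx : x.1 = x.2 <;> by_cases hy : y.1 = y.2 <;> simp [hx, hy, eq_comm]

lemma choi_eq_comp (φ : Map n) : choi φ =
    Matrix.comp (Fin n) (Fin n) (Fin n) (Fin n) ℂ ((of fun i j => single i j 1).map φ) := by
  ext x y
  exact choi_apply φ x y

lemma IsCP.posSemidef_choi {φ : Map n} (h : IsCP φ) : (choi φ).PosSemidef := by
  rw [choi_eq_comp]
  refine h n _ ?_
  have h_one : Matrix.comp (Fin n) (Fin n) (Fin n) (Fin n) ℂ (of fun i j => single i j 1) =
      vecMulVec (vec 1) (star (vec 1)) := by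
    rw [star_vec_one, ← choi_one, choi_eq_comp]
    rfl
  exact h_one ▸ posSemidef_vecMulVec_self_star _

open scoped Kronecker in
lemma isCP_of_posSemidef_choi {φ : Map n} (h : (choi φ).PosSemidef) : IsCP φ := by
  intro k A hA
  let W : Matrix ((Fin k × Fin n) × (Fin n × Fin n)) (Fin k × Fin n) ℂ :=
    of fun p q => if p.1.1 = q.1 ∧ p.1.2 = p.2.1 ∧ p.2.2 = q.2 then 1 else 0
  have hW (p q) : W p q = if p.1.1 = q.1 ∧ p.1.2 = p.2.1 ∧ p.2.2 = q.2 then 1 else 0 := rfl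
  have h_factor : Matrix.comp (Fin k) (Fin k) (Fin n) (Fin n) ℂ (A.map φ) =
      Wᴴ * (Matrix.comp (Fin k) (Fin k) (Fin n) (Fin n) ℂ A ⊗ₖ choi φ) * W := by
    ext ⟨i, p⟩ ⟨j, q⟩
    simp only [Matrix.comp_apply, map_apply, map_apply_eq_sum_choi, mul_apply,
      conjTranspose_apply, hW, Fintype.sum_prod_type, kroneckerMap_apply]
    simp only [ite_and, apply_ite, star_one, star_zero, ite_mul, one_mul, zero_mul, mul_one,
      mul_zero, Finset.sum_ite_eq, Finset.sum_ite_eq', Finset.mem_univ, if_true,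
      Finset.sum_ite_irrel, Finset.sum_const_zero]
    rw [Finset.sum_comm]
  rw [h_factor]
  exact (hA.kronecker h).conjTranspose_mul_mul_same W

lemma isCP_iff_posSemidef_choi {φ : Map n} : IsCP φ ↔ (choi φ).PosSemidef :=
  ⟨IsCP.posSemidef_choi, isCP_of_posSemidef_choi⟩

lemma isCP_zero : IsCP (0 : Map n) := by
  simpa only [isCP_iff_posSemidef_choi, map_zero] using PosSemidef.zero

lemma isCP_one : IsCP (1 : Map n) := fun _ _ hA => hA

lemma IsCP.smul {φ : Map n} (h : IsCP φ) {c : ℝ} (hc : 0 ≤ c) : IsCP ((c : ℂ) • φ) := by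
  rw [isCP_iff_posSemidef_choi, map_smul]
  exact h.posSemidef_choi.smul (Complex.zero_le_real.mpr hc)

lemma IsCP.mul {φ ψ : Map n} (h : IsCP φ) (h' : IsCP ψ) : IsCP (φ * ψ) :=
  fun k A hA => h k _ (h' k A hA)

lemma IsCP.posSemidef {φ : Map n} (h : IsCP φ) {A : Mat n} (hA : A.PosSemidef) :
    (φ A).PosSemidef :=
  (h 1 (fun _ _ => A) (hA.submatrix Prod.snd)).submatrix fun i => (0, i)

lemma IsCP.map_star {φ : Map n} (h : IsCP φ) (A : Mat n) : φ (star A) = star (φ A) := by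
  ext k l
  rw [star_apply, map_apply_eq_sum_choi, map_apply_eq_sum_choi, Finset.sum_comm]
  simp only [star_sum, star_mul', star_apply, h.posSemidef_choi.isHermitian.apply]

lemma isHermitian_choi {φ : Map n} (h : ∀ A, φ (star A) = star (φ A)) :
    (choi φ).IsHermitian := by
  ext x y
  rw [conjTranspose_apply, choi_apply, choi_apply, ← star_apply, ← h, star_eq_conjTranspose,
    conjTranspose_single, star_one]

lemma map_one_apply_eq_sum_choi (φ : Map n) (k : Fin n) :
    φ 1 k k = ∑ i, choi φ (i, k) (i, k) := by
  simp [map_apply_eq_sum_choi, one_apply]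

lemma IsCP.eq_zero_of_map_one {φ : Map n} (h : IsCP φ) (h1 : φ 1 = 0) : φ = 0 := by
  rw [← choi.map_eq_zero_iff, ← h.posSemidef_choi.trace_eq_zero_iff, trace,
    Fintype.sum_prod_type, Finset.sum_comm]
  simp only [diag_apply, ← map_one_apply_eq_sum_choi, h1, Matrix.zero_apply, Finset.sum_const_zero]

lemma IsCP.norm_choi_apply_le {φ : Map n} (h : IsCP φ) {c : ℝ} (hc : 0 ≤ c)
    (h1 : ((c : ℂ) • (1 : Mat n) - φ 1).PosSemidef) (x y : Fin n × Fin n) :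
    ‖choi φ x y‖ ≤ c := by
  have h_diag_nonneg (x) : 0 ≤ choi φ x x := h.posSemidef_choi.diag_nonneg
  have h_diag_le (x : Fin n × Fin n) : choi φ x x ≤ c := calc
    choi φ x x ≤ ∑ i, choi φ (i, x.2) (i, x.2) :=
      Finset.single_le_sum (f := fun i => choi φ (i, x.2) (i, x.2)) (fun i _ => h_diag_nonneg _)
        (Finset.mem_univ x.1)
    _ = φ 1 x.2 x.2 := (map_one_apply_eq_sum_choi φ x.2).symm
    _ ≤ c := by simpa using h1.diag_nonneg (i := x.2)
  have h_re_nonneg (x) : 0 ≤ (choi φ x x).re := (Complex.le_def.mp (h_diag_nonneg x)).1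
  have h_re_le (x) : (choi φ x x).re ≤ c := (Complex.le_def.mp (h_diag_le x)).1
  refine abs_le_of_sq_le_sq' ?_ hc |>.2
  calc ‖choi φ x y‖ ^ 2 ≤ (choi φ x x).re * (choi φ y y).re :=
        norm_sq_apply_le_of_posSemidef h.posSemidef_choi x y
    _ ≤ c ^ 2 := by
        rw [sq]
        exact mul_le_mul (h_re_le x) (h_re_le y) (h_re_nonneg y) hc

section Limits

variable {α : Type*} {l : Filter α} {θ : α → Map n} {θ₀ : Map n}

lemma isCP_of_tendsto_choi [l.NeBot] (h : Tendsto (fun a => choi (θ a)) l (𝓝 (choi θ₀)))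
    (hθ : ∀ᶠ a in l, IsCP (θ a)) : IsCP θ₀ :=
  isCP_iff_posSemidef_choi.mpr <| isClosed_setOf_posSemidef.mem_of_tendsto h <|
    hθ.mono fun _ => IsCP.posSemidef_choi

lemma tendsto_choi_map (f : Map n →ₗ[ℂ] Map n)
    (h : Tendsto (fun a => choi (θ a)) l (𝓝 (choi θ₀))) :
    Tendsto (fun a => choi (f (θ a))) l (𝓝 (choi (f θ₀))) := by
  have h_cont := (choi.toLinearMap ∘ₗ f ∘ₗ choi.symm.toLinearMap).continuous_of_finiteDimensional
  simpa [Function.comp_def] using (h_cont.tendsto (choi θ₀)).comp h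

end Limits

/-! ### Resolvents -/

lemma noNegEigenvalue_iff {φ : Map n} :
    NoNegEigenvalue φ ↔ ∀ t : ℝ, 0 ≤ t → IsUnit (1 + (t : ℂ) • φ) := by
  have h_eigenvalue {r : ℝ} (hr : r ≠ 0) :
      ¬ Module.End.HasEigenvalue φ (r : ℂ) ↔ IsUnit (1 + ((-r⁻¹ : ℝ) : ℂ) • φ) := by
    have hr' : (r : ℂ) ≠ 0 := Complex.ofReal_ne_zero.mpr hr
    have h_smul : algebraMap ℂ (Map n) r - φ =
        Units.mk0 (r : ℂ) hr' • (1 + ((-r⁻¹ : ℝ) : ℂ) • φ) := by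
      rw [Units.smul_mk0, smul_add, Algebra.algebraMap_eq_smul_one, smul_smul]
      push_cast
      rw [mul_neg, mul_inv_cancel₀ hr', neg_one_smul, sub_eq_add_neg]
    rw [Module.End.hasEigenvalue_iff_mem_spectrum, spectrum.mem_iff, not_not, h_smul,
      isUnit_smul_iff]
  refine ⟨fun h t ht => ?_, fun h r hr => (h_eigenvalue hr.ne).mpr (h _ ?_)⟩
  · rcases ht.eq_or_lt with rfl | ht
    · simp
    · simpa using (h_eigenvalue (neg_ne_zero.mpr (inv_ne_zero ht.ne'))).mp
        (h _ (neg_lt_zero.mpr (inv_pos.mpr ht)))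
  · simpa using hr.le

lemma IsQPositive.isUnit {φ : Map n} (h : IsQPositive φ) {t : ℝ} (ht : 0 ≤ t) :
    IsUnit (1 + (t : ℂ) • φ) := noNegEigenvalue_iff.mp h.1 t ht

lemma IsQPositive.isCP_resolvent {φ : Map n} (h : IsQPositive φ) {t : ℝ} (ht : 0 ≤ t) :
    IsCP (resolvent φ t) := h.2 t ht

section Resolvent

variable {φ : Map n} {s t : ℝ}

lemma resolvent_mul_one_add_smul (h : IsUnit (1 + (t : ℂ) • φ)) :
    resolvent φ t * (1 + (t : ℂ) • φ) = φ :=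
  Ring.inverse_mul_cancel_right _ _ h

lemma resolvent_eq_iff (h : IsUnit (1 + (t : ℂ) • φ)) {θ : Map n} :
    resolvent φ t = θ ↔ θ * (1 + (t : ℂ) • φ) = φ :=
  eq_comm.trans (Ring.eq_mul_inverse_iff_mul_eq _ _ _ h)

lemma resolvent_eq_inverse_mul (h : IsUnit (1 + (t : ℂ) • φ)) :
    resolvent φ t = Ring.inverse (1 + (t : ℂ) • φ) * φ := by
  have h_comm : φ * (1 + (t : ℂ) • φ) = (1 + (t : ℂ) • φ) * φ := by
    simp only [mul_add, add_mul, mul_one, one_mul, mul_smul_comm, smul_mul_assoc]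
  rw [resolvent_eq_iff h, mul_assoc, h_comm, Ring.inverse_mul_cancel_left _ _ h]

lemma one_add_smul_mul_resolvent (h : IsUnit (1 + (t : ℂ) • φ)) :
    (1 + (t : ℂ) • φ) * resolvent φ t = φ := by
  rw [resolvent_eq_inverse_mul h, Ring.mul_inverse_cancel_left _ _ h]

lemma resolvent_zero_right (φ : Map n) : resolvent φ 0 = φ := by
  simp [resolvent]

lemma resolvent_zero_left (t : ℝ) : resolvent (0 : Map n) t = 0 := by
  simp [resolvent]

lemma IsQPositive.isCP (h : IsQPositive φ) : IsCP φ := by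
  simpa only [resolvent_zero_right] using h.isCP_resolvent le_rfl

lemma resolvent_sub_resolvent (hs : IsUnit (1 + (s : ℂ) • φ)) (ht : IsUnit (1 + (t : ℂ) • φ)) :
    resolvent φ s - resolvent φ t = ((t - s : ℝ) : ℂ) • (resolvent φ s * resolvent φ t) := by
  set R := Ring.inverse (1 + (s : ℂ) • φ)
  set R' := Ring.inverse (1 + (t : ℂ) • φ)
  have h_numerators : φ * (1 + (t : ℂ) • φ) - (1 + (s : ℂ) • φ) * φ =
      ((t - s : ℝ) : ℂ) • (φ * φ) := by
    simp only [mul_add, add_mul, mul_one, one_mul, mul_smul_comm, smul_mul_assoc]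
    match_scalars <;> ring
  calc resolvent φ s - resolvent φ t = R * φ - φ * R' := by
        rw [resolvent_eq_inverse_mul hs, resolvent]
    _ = R * (φ * (1 + (t : ℂ) • φ) - (1 + (s : ℂ) • φ) * φ) * R' := by
        rw [mul_sub, sub_mul, mul_assoc R, Ring.mul_inverse_cancel_right _ _ ht,
          Ring.inverse_mul_cancel_left _ _ hs]
    _ = ((t - s : ℝ) : ℂ) • (resolvent φ s * resolvent φ t) := by
        rw [h_numerators, resolvent_eq_inverse_mul hs, resolvent]
        simp only [mul_smul_comm, smul_mul_assoc, mul_assoc, R, R']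

lemma one_add_smul_resolvent (hs : IsUnit (1 + (s : ℂ) • φ)) :
    1 + (t : ℂ) • resolvent φ s =
      (1 + ((s + t : ℝ) : ℂ) • φ) * Ring.inverse (1 + (s : ℂ) • φ) := by
  rw [Ring.eq_mul_inverse_iff_mul_eq _ _ _ hs, add_mul, one_mul, smul_mul_assoc,
    resolvent_mul_one_add_smul hs]
  push_cast
  module

lemma isUnit_one_add_smul_resolvent (hs : IsUnit (1 + (s : ℂ) • φ))
    (hst : IsUnit (1 + ((s + t : ℝ) : ℂ) • φ)) : IsUnit (1 + (t : ℂ) • resolvent φ s) := by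
  rw [one_add_smul_resolvent hs]
  exact hst.mul hs.ringInverse

lemma resolvent_resolvent (hs : IsUnit (1 + (s : ℂ) • φ))
    (hst : IsUnit (1 + ((s + t : ℝ) : ℂ) • φ)) :
    resolvent (resolvent φ s) t = resolvent φ (s + t) := by
  rw [resolvent_eq_iff (isUnit_one_add_smul_resolvent hs hst), one_add_smul_resolvent hs,
    ← mul_assoc, resolvent_mul_one_add_smul hst, resolvent]

lemma resolvent_apply_one (h : IsUnit (1 + (t : ℂ) • φ)) (h1 : φ 1 = 1) (ht : 0 ≤ t) :
    resolvent φ t 1 = ((1 / (1 + t) : ℝ) : ℂ) • (1 : Mat n) := by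
  have h_one : (1 + (t : ℂ)) • resolvent φ t 1 = 1 := by
    have := LinearMap.congr_fun (resolvent_mul_one_add_smul h) 1
    rw [Module.End.mul_apply] at this
    simpa [h1, add_smul] using this
  have h_ne : (1 + (t : ℂ)) ≠ 0 := by exact_mod_cast (by positivity : (1 + t : ℝ) ≠ 0)
  push_cast
  rw [one_div, eq_inv_smul_iff₀ h_ne, h_one]

lemma one_add_smul_unit (φ : (Map n)ˣ) (t : ℝ) :
    1 + (t : ℂ) • (φ : Map n) = (↑φ⁻¹ + (t : ℂ) • 1) * φ := by
  rw [add_mul, smul_mul_assoc, one_mul, Units.inv_mul]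

lemma isUnit_one_add_smul_unit_iff {φ : (Map n)ˣ} :
    IsUnit (1 + (t : ℂ) • (φ : Map n)) ↔ IsUnit ((↑φ⁻¹ : Map n) + (t : ℂ) • 1) := by
  rw [one_add_smul_unit, Units.isUnit_mul_units]

lemma resolvent_unit (φ : (Map n)ˣ) (t : ℝ) :
    resolvent (φ : Map n) t = Ring.inverse ((↑φ⁻¹ : Map n) + (t : ℂ) • 1) := by
  rw [resolvent, one_add_smul_unit, Ring.inverse_mul (.inr φ.isUnit), Ring.inverse_unit,
    Units.mul_inv_cancel_left]

end Resolvent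

/-! ### Conjugation -/

section Conjugation

variable {u : (Map n)ˣ} {φ ψ : Map n} {t : ℝ}

lemma one_add_smul_conj (u : (Map n)ˣ) (φ : Map n) (t : ℝ) :
    1 + (t : ℂ) • (u * φ * ↑u⁻¹ : Map n) = u * (1 + (t : ℂ) • φ) * ↑u⁻¹ := by
  simp only [mul_add, add_mul, mul_one, mul_smul_comm, smul_mul_assoc, Units.mul_inv]

lemma resolvent_conj (u : (Map n)ˣ) (φ : Map n) (t : ℝ) :
    resolvent (u * φ * ↑u⁻¹ : Map n) t = u * resolvent φ t * ↑u⁻¹ := by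
  rw [resolvent, one_add_smul_conj, Ring.inverse_mul (.inr u⁻¹.isUnit),
    Ring.inverse_mul (.inl u.isUnit), Ring.inverse_unit, Ring.inverse_unit, inv_inv, resolvent]
  simp only [mul_assoc, Units.inv_mul_cancel_left]

lemma IsQPositive.conj (hu : IsCP (u : Map n)) (hu' : IsCP (↑u⁻¹ : Map n))
    (h : IsQPositive φ) : IsQPositive (u * φ * ↑u⁻¹ : Map n) := by
  refine ⟨noNegEigenvalue_iff.mpr fun t ht => ?_, fun t ht => ?_⟩
  · rw [one_add_smul_conj]
    exact (u.isUnit.mul (h.isUnit ht)).mul u⁻¹.isUnit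
  · rw [resolvent_conj]
    exact (hu.mul (h.isCP_resolvent ht)).mul hu'

lemma QDominates.conj (hu : IsCP (u : Map n)) (hu' : IsCP (↑u⁻¹ : Map n))
    (h : QDominates φ ψ) : QDominates (u * φ * ↑u⁻¹ : Map n) (u * ψ * ↑u⁻¹) := by
  refine ⟨h.1.conj hu hu', h.2.1.conj hu hu', fun t ht => ?_⟩
  rw [resolvent_conj, resolvent_conj, ← sub_mul, ← mul_sub]
  exact (hu.mul (h.2.2 t ht)).mul hu'

end Conjugation

/-! ### Subordinates -/

lemma isQPositive_zero : IsQPositive (0 : Map n) := by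
  refine ⟨noNegEigenvalue_iff.mpr fun t _ => by simp, fun t _ => ?_⟩
  rw [resolvent_zero_left]
  exact isCP_zero

lemma IsQPositive.isQPositive_resolvent {φ : Map n} (h : IsQPositive φ) {s : ℝ} (hs : 0 ≤ s) :
    IsQPositive (resolvent φ s) := by
  refine ⟨noNegEigenvalue_iff.mpr fun t ht => ?_, fun t ht => ?_⟩
  · exact isUnit_one_add_smul_resolvent (h.isUnit hs) (h.isUnit (add_nonneg hs ht))
  · rw [resolvent_resolvent (h.isUnit hs) (h.isUnit (add_nonneg hs ht))]
    exact h.isCP_resolvent (add_nonneg hs ht)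

lemma IsQPositive.qDominates_zero {φ : Map n} (h : IsQPositive φ) : QDominates φ 0 := by
  refine ⟨h, isQPositive_zero, fun t ht => ?_⟩
  rw [resolvent_zero_left, sub_zero]
  exact h.isCP_resolvent ht

lemma IsQPositive.qDominates_resolvent {φ : Map n} (h : IsQPositive φ) {s : ℝ} (hs : 0 ≤ s) :
    QDominates φ (resolvent φ s) := by
  refine ⟨h, h.isQPositive_resolvent hs, fun t ht => ?_⟩
  have hst := add_nonneg hs ht
  rw [resolvent_resolvent (h.isUnit hs) (h.isUnit hst),
    resolvent_sub_resolvent (h.isUnit ht) (h.isUnit hst)]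
  exact ((h.isCP_resolvent ht).mul (h.isCP_resolvent hst)).smul (by simpa using hs)

lemma IsQPositive.qDominates_self {φ : Map n} (h : IsQPositive φ) : QDominates φ φ := by
  simpa only [resolvent_zero_right] using h.qDominates_resolvent le_rfl

lemma isQPure_iff {φ : Map n} : IsQPure φ ↔ IsQPositive φ ∧
    ∀ ψ, QDominates φ ψ → ψ = 0 ∨ ∃ s : ℝ, 0 ≤ s ∧ ψ = resolvent φ s := by
  refine and_congr_right fun h => ?_
  rw [Set.Subset.antisymm_iff, and_iff_left]
  · exact forall_congr' fun ψ => imp_congr_right fun _ => or_comm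
  · rintro ψ (⟨s, hs, rfl⟩ | rfl)
    exacts [h.qDominates_resolvent hs, h.qDominates_zero]

lemma IsQPure.conj {u : (Map n)ˣ} (hu : IsCP (u : Map n)) (hu' : IsCP (↑u⁻¹ : Map n)) {φ : Map n}
    (h : IsQPure φ) : IsQPure (u * φ * ↑u⁻¹ : Map n) := by
  rw [isQPure_iff] at h ⊢
  refine ⟨h.1.conj hu hu', fun ψ hψ => ?_⟩
  obtain ⟨ψ, rfl⟩ : ∃ θ : Map n, ψ = u * θ * ↑u⁻¹ := ⟨↑u⁻¹ * ψ * u, by simp [mul_assoc]⟩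
  have hφψ : QDominates φ ψ := by
    simpa [mul_assoc] using hψ.conj (u := u⁻¹) hu' (by simpa using hu)
  rcases h.2 ψ hφψ with rfl | ⟨s, hs, rfl⟩
  · exact .inl (by simp)
  · exact .inr ⟨s, hs, (resolvent_conj u φ s).symm⟩

/-! ### Multiples of idempotents -/

section MulSelf

variable {φ : Map n} {c t : ℝ}

lemma isUnit_one_add_smul_of_mul_self (h : φ * φ = (c : ℂ) • φ) (ht : 1 + t * c ≠ 0) :
    IsUnit (1 + (t : ℂ) • φ) := by
  have ht' : (1 : ℂ) + t * c ≠ 0 := by exact_mod_cast ht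
  refine ⟨⟨1 + (t : ℂ) • φ, 1 - ((t : ℂ) / (1 + t * c)) • φ, ?_, ?_⟩, rfl⟩
  all_goals
    simp only [mul_sub, sub_mul, mul_add, add_mul, mul_one, one_mul, mul_smul_comm,
      smul_mul_assoc, h, smul_smul]
    match_scalars
    all_goals field_simp
    all_goals ring

lemma resolvent_of_mul_self (h : φ * φ = (c : ℂ) • φ) (ht : 1 + t * c ≠ 0) :
    resolvent φ t = ((1 / (1 + t * c) : ℝ) : ℂ) • φ := by
  have ht' : (1 : ℂ) + t * c ≠ 0 := by exact_mod_cast ht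
  rw [resolvent_eq_iff (isUnit_one_add_smul_of_mul_self h ht)]
  simp only [mul_add, mul_one, mul_smul_comm, smul_mul_assoc, h, smul_smul]
  match_scalars
  field_simp

lemma IsCP.isQPositive_of_mul_self (hφ : IsCP φ) (hc : 0 ≤ c) (h : φ * φ = (c : ℂ) • φ) :
    IsQPositive φ := by
  have h_ne {t : ℝ} (ht : 0 ≤ t) : 1 + t * c ≠ 0 := by positivity
  refine ⟨noNegEigenvalue_iff.mpr fun t ht => isUnit_one_add_smul_of_mul_self h (h_ne ht),
    fun t ht => ?_⟩
  rw [resolvent_of_mul_self h (h_ne ht)]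
  exact hφ.smul (by positivity)

end MulSelf

/-! ### Unitary conjugation -/

lemma isCP_mulLeftRight_star (V : Mat n) : IsCP (LinearMap.mulLeftRight ℂ (V, star V)) := by
  rw [isCP_iff_posSemidef_choi]
  convert posSemidef_vecMulVec_self_star (vec V) using 1
  ext x y
  simp [choi_apply, vecMulVec_apply, mul_apply, single_apply, ite_and, star_apply]

/-- The maps `A ↦ U A U*`, as a group homomorphism into the invertible linear maps. -/
def unitaryConj : unitaryGroup (Fin n) ℂ →* (Map n)ˣ :=
  MonoidHom.toHomUnits
    { toFun U := LinearMap.mulLeftRight ℂ ((U : Mat n), star (U : Mat n))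
      map_one' := by ext; simp
      map_mul' U V := LinearMap.ext fun A => by simp [mul_assoc] }

lemma unitaryConj_apply (U : unitaryGroup (Fin n) ℂ) (A : Mat n) :
    (unitaryConj U : Map n) A = U * A * star (U : Mat n) := rfl

lemma isCP_unitaryConj (U : unitaryGroup (Fin n) ℂ) : IsCP (unitaryConj U : Map n) :=
  isCP_mulLeftRight_star _

lemma unitaryConj_apply_one (U : unitaryGroup (Fin n) ℂ) : (unitaryConj U : Map n) 1 = 1 := by
  simp [unitaryConj_apply]

lemma isConjugateTo_iff {φ ψ : Map n} : IsConjugateTo φ ψ ↔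
    ∃ U : unitaryGroup (Fin n) ℂ, φ = unitaryConj U * ψ * ↑(unitaryConj U)⁻¹ := by
  have h_eq (U : unitaryGroup (Fin n) ℂ) :
      (φ = unitaryConj U⁻¹ * ψ * ↑(unitaryConj U⁻¹)⁻¹) ↔
        ∀ A, φ A = star (U : Mat n) * ψ (U * A * star (U : Mat n)) * U := by
    rw [← map_inv, inv_inv, LinearMap.ext_iff]
    simp only [Module.End.mul_apply, unitaryConj_apply, UnitaryGroup.inv_val, star_star]
  constructor
  · rintro ⟨U, hU, h⟩
    exact ⟨_, (h_eq ⟨U, hU⟩).mpr h⟩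
  · rintro ⟨U, h⟩
    exact ⟨_, (U⁻¹).2, (h_eq U⁻¹).mp (by rwa [inv_inv])⟩

lemma IsConjugateTo.isQPure {φ ψ : Map n} (h : IsConjugateTo φ ψ) (hψ : IsQPure ψ) :
    IsQPure φ := by
  obtain ⟨U, rfl⟩ := isConjugateTo_iff.mp h
  exact hψ.conj (isCP_unitaryConj U) (map_inv unitaryConj U ▸ isCP_unitaryConj U⁻¹)

/-! ### Limits of `t φ (1 + t φ)⁻¹` -/

section ResolventBound

variable {φ ψ : Map n}

lemma QDominates.norm_choi_resolvent_le (h : QDominates φ ψ) (h1 : φ 1 = 1) {t : ℝ} (ht : 0 ≤ t)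
    (x y : Fin n × Fin n) : ‖choi (resolvent ψ t) x y‖ ≤ 1 / (1 + t) := by
  refine (h.2.1.isCP_resolvent ht).norm_choi_apply_le (by positivity) ?_ x y
  rw [← resolvent_apply_one (h.1.isUnit ht) h1 ht, ← LinearMap.sub_apply]
  exact (h.2.2 t ht).posSemidef PosSemidef.one

lemma QDominates.tendsto_choi_resolvent (h : QDominates φ ψ) (h1 : φ 1 = 1) :
    Tendsto (fun t : ℝ => choi (resolvent ψ t)) atTop (𝓝 (choi 0)) := by
  have h_bound : Tendsto (fun t : ℝ => 1 / (1 + t)) atTop (𝓝 0) :=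
    tendsto_const_nhds.div_atTop (tendsto_atTop_add_const_left _ _ tendsto_id)
  rw [map_zero]
  refine tendsto_pi_nhds.mpr fun x => tendsto_pi_nhds.mpr fun y => ?_
  refine squeeze_zero_norm' ?_ h_bound
  filter_upwards [eventually_ge_atTop 0] with t ht
  exact h.norm_choi_resolvent_le h1 ht x y

end ResolventBound

/- With `θ` an inverse of `φ` the limit is `1`, and with `θ = 1` an idempotent `φ` is its own
limit. -/
lemma IsQPositive.tendsto_choi_smul_resolvent {φ θ : Map n} (h : IsQPositive φ) (h1 : φ 1 = 1)
    (hθ : φ * φ * θ = φ) :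
    Tendsto (fun t : ℝ => choi ((t : ℂ) • resolvent φ t)) atTop (𝓝 (choi (φ * θ))) := by
  have h_sub : Tendsto (fun t : ℝ => choi ((φ - resolvent φ t) * θ)) atTop (𝓝 (choi (φ * θ))) := by
    have h_mul := tendsto_choi_map (LinearMap.mulRight ℂ θ)
      (h.qDominates_self.tendsto_choi_resolvent h1)
    simpa [sub_mul] using (tendsto_const_nhds (x := choi (φ * θ))).sub h_mul
  refine h_sub.congr' ?_
  filter_upwards [eventually_ge_atTop 0] with t ht
  have hφ_t : resolvent φ t * φ * θ = resolvent φ t := by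
    rw [resolvent_eq_inverse_mul (h.isUnit ht), mul_assoc (Ring.inverse _), mul_assoc, hθ]
  have h_sub_eq : φ - resolvent φ t = (t : ℂ) • (resolvent φ t * φ) := by
    rw [sub_eq_iff_eq_add', ← mul_smul_comm, ← mul_one_add,
      resolvent_mul_one_add_smul (h.isUnit ht)]
  rw [h_sub_eq, smul_mul_assoc, hφ_t]

/-- `L` is a cluster point of `t φ (1 + t φ)⁻¹` as `t → ∞`. For a `q`-subordinate `φ` of a unital
map such an `L` exists; it is an idempotent with the range and the kernel of `φ`. -/
def IsResolventLimit (φ L : Map n) : Prop :=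
  MapClusterPt (choi L) atTop fun t : ℝ => choi ((t : ℂ) • resolvent φ t)

lemma QDominates.exists_isResolventLimit {φ ψ : Map n} (h : QDominates φ ψ) (h1 : φ 1 = 1) :
    ∃ L, IsResolventLimit ψ L := by
  have h_compact : IsCompact (Set.univ.pi fun _ => Set.univ.pi fun _ => Metric.closedBall 0 1 :
      Set (Matrix (Fin n × Fin n) (Fin n × Fin n) ℂ)) :=
    isCompact_univ_pi fun _ => isCompact_univ_pi fun _ => isCompact_closedBall 0 1
  have h_mem : ∀ᶠ t : ℝ in atTop, choi ((t : ℂ) • resolvent ψ t) ∈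
      (Set.univ.pi fun _ => Set.univ.pi fun _ => Metric.closedBall 0 1 :
        Set (Matrix (Fin n × Fin n) (Fin n × Fin n) ℂ)) := by
    filter_upwards [eventually_ge_atTop 0] with t ht x _ y _
    rw [mem_closedBall_zero_iff, map_smul, Matrix.smul_apply, norm_smul, Complex.norm_real,
      Real.norm_of_nonneg ht]
    calc t * ‖choi (resolvent ψ t) x y‖ ≤ t * (1 / (1 + t)) :=
          mul_le_mul_of_nonneg_left (h.norm_choi_resolvent_le h1 ht x y) ht
      _ ≤ 1 := by
          rw [mul_one_div]
          exact div_le_one_of_le₀ (by linarith) (by linarith)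
  obtain ⟨M, -, hM⟩ := h_compact.exists_mapClusterPt_of_frequently h_mem.frequently
  refine ⟨choi.symm (of M), ?_⟩
  rw [IsResolventLimit, LinearEquiv.apply_symm_apply]
  exact hM

namespace IsResolventLimit

variable {φ ψ L Φ : Map n}

lemma exists_filter (hL : IsResolventLimit φ L) : ∃ l : Filter ℝ, l.NeBot ∧ l ≤ atTop ∧
    Tendsto (fun t : ℝ => choi ((t : ℂ) • resolvent φ t)) l (𝓝 (choi L)) := by
  obtain ⟨l, hl, h⟩ := mapClusterPt_iff_ultrafilter.mp hL
  exact ⟨l, l.neBot, hl, h⟩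

lemma isCP (hL : IsResolventLimit φ L) (h : IsQPositive φ) : IsCP L := by
  obtain ⟨l, _, hl, h'⟩ := hL.exists_filter
  refine isCP_of_tendsto_choi h' (hl ?_)
  filter_upwards [eventually_ge_atTop 0] with t ht using (h.isCP_resolvent ht).smul ht

lemma isCP_sub (hL : IsResolventLimit ψ L) (h : QDominates φ ψ)
    (hΦ : Tendsto (fun t : ℝ => choi ((t : ℂ) • resolvent φ t)) atTop (𝓝 (choi Φ))) :
    IsCP (Φ - L) := by
  obtain ⟨l, _, hl, h'⟩ := hL.exists_filter
  have h_sub : Tendsto (fun t : ℝ => choi ((t : ℂ) • (resolvent φ t - resolvent ψ t))) l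
      (𝓝 (choi (Φ - L))) := by
    simpa only [smul_sub, map_sub] using (hΦ.mono_left hl).sub h'
  refine isCP_of_tendsto_choi h_sub (hl ?_)
  filter_upwards [eventually_ge_atTop 0] with t ht using (h.2.2 t ht).smul ht

lemma mul_eq_zero_of_mul_eq_zero (hL : IsResolventLimit ψ L) (h : IsQPositive ψ) {θ : Map n}
    (hθ : ψ * θ = 0) : L * θ = 0 := by
  obtain ⟨l, _, hl, h'⟩ := hL.exists_filter
  have h_mul := tendsto_choi_map (LinearMap.mulRight ℂ θ) h'
  refine choi.injective (tendsto_nhds_unique (h_mul.congr' (hl ?_)) tendsto_const_nhds)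
  filter_upwards [eventually_ge_atTop 0] with t ht
  rw [LinearMap.mulRight_apply, smul_mul_assoc, resolvent_eq_inverse_mul (h.isUnit ht), mul_assoc,
    hθ, mul_zero, smul_zero]

lemma isUnit (hL : IsResolventLimit ψ 1) (h : IsQPositive ψ) : IsUnit ψ := by
  have : IsArtinianRing (Map n)ᵐᵒᵖ := .of_finite ℂ _
  rw [IsArtinianRing.isUnit_iff_isLeftRegular, isLeftRegular_iff_right_eq_zero_of_mul]
  intro θ hθ
  rw [← one_mul θ, hL.mul_eq_zero_of_mul_eq_zero h hθ]

section Idempotent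

variable (hL : IsResolventLimit ψ L) (h : QDominates φ ψ) (h1 : φ 1 = 1)
include hL h h1

lemma mul_eq_right : L * ψ = ψ := by
  obtain ⟨l, _, hl, h'⟩ := hL.exists_filter
  have h_left := tendsto_choi_map (LinearMap.mulRight ℂ ψ) h'
  have h_right := (h.tendsto_choi_resolvent h1).mono_left hl
  have h_sum := h_left.add h_right
  simp only [← map_add, LinearMap.mulRight_apply, add_zero] at h_sum
  refine choi.injective (tendsto_nhds_unique (h_sum.congr' (hl ?_)) tendsto_const_nhds)
  filter_upwards [eventually_ge_atTop 0] with t ht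
  rw [smul_mul_assoc, ← mul_smul_comm, ← mul_add_one, add_comm,
    resolvent_mul_one_add_smul (h.2.1.isUnit ht)]

lemma mul_eq_left : ψ * L = ψ := by
  obtain ⟨l, _, hl, h'⟩ := hL.exists_filter
  have h_left := tendsto_choi_map (LinearMap.mulLeft ℂ ψ) h'
  have h_right := (h.tendsto_choi_resolvent h1).mono_left hl
  have h_sum := h_left.add h_right
  simp only [← map_add, LinearMap.mulLeft_apply, add_zero] at h_sum
  refine choi.injective (tendsto_nhds_unique (h_sum.congr' (hl ?_)) tendsto_const_nhds)
  filter_upwards [eventually_ge_atTop 0] with t ht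
  rw [mul_smul_comm, ← smul_mul_assoc, ← add_one_mul, add_comm,
    one_add_smul_mul_resolvent (h.2.1.isUnit ht)]

lemma mul_self : L * L = L := by
  have h_ker : ψ * (1 - L) = 0 := by rw [mul_sub, mul_one, hL.mul_eq_left h h1, sub_self]
  have := hL.mul_eq_zero_of_mul_eq_zero h.2.1 h_ker
  rwa [mul_sub, mul_one, sub_eq_zero, eq_comm] at this

end Idempotent

end IsResolventLimit

/-! ### Maps of rank one -/

section SMulRight

variable {ρ : Mat n →ₗ[ℂ] ℂ}

open scoped Kronecker in
lemma isCP_smulRight (hρ : ∀ A : Mat n, A.PosSemidef → 0 ≤ ρ A) {B : Mat n}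
    (hB : B.PosSemidef) : IsCP (ρ.smulRight B) := by
  have h_density : (of fun i j => ρ (single i j 1) : Mat n).PosSemidef := by
    refine posSemidef_of_forall_dotProduct_mulVec_nonneg fun x => ?_
    convert hρ _ (posSemidef_vecMulVec_star_self x) using 1
    conv_rhs => rw [matrix_eq_sum_single (vecMulVec (star x) x)]
    simp only [map_sum, dotProduct, mulVec, Finset.mul_sum, of_apply, vecMulVec_apply]
    refine Finset.sum_congr rfl fun i _ => Finset.sum_congr rfl fun j _ => ?_
    have h_single : single i j (star x i * x j) = (star x i * x j) • single i j (1 : ℂ) := by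
      rw [smul_single, smul_eq_mul, mul_one]
    rw [h_single, map_smul, smul_eq_mul]
    ring
  have h_choi : choi (ρ.smulRight B) = of (fun i j => ρ (single i j 1)) ⊗ₖ B := by
    ext x y
    rw [choi_apply, LinearMap.smulRight_apply, Matrix.smul_apply, kroneckerMap_apply, of_apply,
      smul_eq_mul]
  rw [isCP_iff_posSemidef_choi, h_choi]
  exact h_density.kronecker hB

lemma smulRight_mul_self {B : Mat n} (h : ρ B = 1) :
    (ρ.smulRight B : Map n) * ρ.smulRight B = ((1 : ℝ) : ℂ) • ρ.smulRight B := by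
  ext A : 1
  simp [h]

lemma resolvent_smulRight {B : Mat n} (h : ρ B = 1) {t : ℝ} (ht : 0 ≤ t) :
    resolvent (ρ.smulRight B) t = ((1 / (1 + t) : ℝ) : ℂ) • ρ.smulRight B := by
  simpa using resolvent_of_mul_self (smulRight_mul_self h) (by positivity : 1 + t * 1 ≠ 0)

lemma isQPositive_smulRight (hρ : ∀ A : Mat n, A.PosSemidef → 0 ≤ ρ A) {B : Mat n}
    (hB : B.PosSemidef) (h : ρ B = 1) : IsQPositive (ρ.smulRight B) :=
  (isCP_smulRight hρ hB).isQPositive_of_mul_self zero_le_one (smulRight_mul_self h)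

/- Faithfulness applied to `(φ - L) (L 1) = ρ (L 1) • 1 - L 1 ≥ 0`, on which `ρ` vanishes, shows
that `L 1` is a scalar. -/
lemma IsFaithfulState.eq_zero_or_eq_smulRight (hρ : IsFaithfulState ρ) {L : Map n} (hL : IsCP L)
    (hL_sq : L * L = L) (hL_le : IsCP (ρ.smulRight 1 - L)) : L = 0 ∨ L = ρ.smulRight 1 := by
  obtain ⟨⟨-, h_one⟩, h_faithful⟩ := hρ
  have hL_apply (A : Mat n) : L (L A) = L A := LinearMap.congr_fun hL_sq A
  have h_pos := hL_le.posSemidef (hL.posSemidef PosSemidef.one)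
  rw [LinearMap.sub_apply, LinearMap.smulRight_apply, hL_apply] at h_pos
  have hL_one : ρ (L 1) • 1 = L 1 :=
    sub_eq_zero.mp (h_faithful _ h_pos (by simp [h_one]))
  have h_scalar : ρ (L 1) • L 1 = L 1 := by
    conv_rhs => rw [← hL_apply, ← hL_one, map_smul]
  have h_cases : (ρ (L 1) - 1) • L 1 = 0 := by rw [sub_smul, one_smul, h_scalar, sub_self]
  rcases smul_eq_zero.mp h_cases with h | h
  · rw [sub_eq_zero.mp h, one_smul] at hL_one
    refine .inr (sub_eq_zero.mp (hL_le.eq_zero_of_map_one ?_)).symm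
    simp [h_one, ← hL_one]
  · exact .inl (hL.eq_zero_of_map_one h)

lemma QDominates.eq_zero_or_resolvent_smulRight (hρ : IsState ρ) {ψ : Map n}
    (h : QDominates (ρ.smulRight 1) ψ) (h_left : ρ.smulRight 1 * ψ = ψ)
    (h_right : ψ * ρ.smulRight 1 = ψ) :
    ψ = 0 ∨ ∃ s : ℝ, 0 ≤ s ∧ ψ = resolvent (ρ.smulRight 1) s := by
  obtain ⟨h_pos, h_one⟩ := hρ
  have hψ : ψ = ρ (ψ 1) • ρ.smulRight 1 := by
    ext A : 1
    conv_lhs => rw [← h_left, ← h_right]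
    simpa using smul_comm _ _ _
  have h_cp : IsCP ψ := h.2.1.isCP
  have h_sub : IsCP (ρ.smulRight 1 - ψ) := by
    simpa only [resolvent_zero_right] using h.2.2 0 le_rfl
  have h_nonneg := h_pos _ (h_cp.posSemidef PosSemidef.one)
  have h_le := h_pos _ (h_sub.posSemidef PosSemidef.one)
  obtain ⟨c, hc⟩ : ∃ c : ℝ, ρ (ψ 1) = c :=
    ⟨_, Complex.eq_re_of_ofReal_le (r := 0) (by simpa using h_nonneg)⟩
  simp only [LinearMap.sub_apply, LinearMap.smulRight_apply, map_sub, map_smul, h_one, hc,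
    smul_eq_mul, mul_one, sub_nonneg] at h_nonneg h_le
  norm_cast at h_nonneg h_le
  rcases h_nonneg.eq_or_lt with rfl | hc_pos
  · exact .inl (by simpa [hc] using hψ)
  · have hs : 0 ≤ 1 / c - 1 := by rwa [sub_nonneg, le_div_iff₀ hc_pos, one_mul]
    refine .inr ⟨1 / c - 1, hs, ?_⟩
    rwa [resolvent_smulRight h_one hs, add_sub_cancel, one_div_one_div, ← hc]

theorem isQPure_smulRight (hρ : IsFaithfulState ρ) : IsQPure (ρ.smulRight (1 : Mat n)) := by
  have h_one : ρ 1 = 1 := hρ.1.2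
  have hφ1 : ρ.smulRight (1 : Mat n) 1 = 1 := by simp [h_one]
  have hφ : IsQPositive (ρ.smulRight 1) := isQPositive_smulRight hρ.1.1 PosSemidef.one h_one
  have hφ_sq : ρ.smulRight (1 : Mat n) * ρ.smulRight 1 * 1 = ρ.smulRight 1 := by
    simpa using smulRight_mul_self h_one
  refine isQPure_iff.mpr ⟨hφ, fun ψ hψ => ?_⟩
  obtain ⟨L, hL⟩ := hψ.exists_isResolventLimit hφ1
  have hL_le := hL.isCP_sub hψ (hφ.tendsto_choi_smul_resolvent hφ1 hφ_sq)
  rw [mul_one] at hL_le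
  have hLψ := hL.mul_eq_right hψ hφ1
  have hψL := hL.mul_eq_left hψ hφ1
  rcases hρ.eq_zero_or_eq_smulRight (hL.isCP hψ.2.1) (hL.mul_self hψ hφ1) hL_le with rfl | rfl
  · exact .inl (by rw [← hLψ, zero_mul])
  · exact hψ.eq_zero_or_resolvent_smulRight hρ.1 hLψ hψL

lemma IsCP.apply_nonneg_of_smulRight_one (h : IsCP (ρ.smulRight (1 : Mat n))) {A : Mat n}
    (hA : A.PosSemidef) : 0 ≤ ρ A := by
  obtain hn | ⟨⟨i⟩⟩ := isEmpty_or_nonempty (Fin n)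
  · rw [Subsingleton.elim A 0, map_zero]
  · simpa using (h.posSemidef hA).diag_nonneg (i := i)

/- If `ρ R = 0` for some `0 ≠ R ≤ 1`, then `A ↦ ρ(A) (1 - R)` is a `q`-subordinate which is not
a multiple of `A ↦ ρ(A) 1`. -/
theorem IsQPure.isFaithfulState (h : IsQPure (ρ.smulRight (1 : Mat n))) (h_one : ρ 1 = 1) :
    IsFaithfulState ρ := by
  have hρ := fun A => h.1.isCP.apply_nonneg_of_smulRight_one (A := A)
  refine ⟨⟨hρ, h_one⟩, fun P hP hρP => ?_⟩
  obtain ⟨c, hc, hcP⟩ := exists_pos_smul_one_sub_posSemidef hP.isHermitian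
  have hc' : (c : ℂ) ≠ 0 := by exact_mod_cast hc.ne'
  set Q : Mat n := 1 - (c : ℂ)⁻¹ • P with hQ_def
  have hQ : Q.PosSemidef := by
    have := hcP.smul (inv_nonneg.mpr (Complex.zero_le_real.mpr hc.le))
    rwa [smul_sub, inv_smul_smul₀ hc'] at this
  have hρQ : ρ Q = 1 := by simp [hQ_def, h_one, hρP]
  have h_dom : QDominates (ρ.smulRight (1 : Mat n)) (ρ.smulRight Q) := by
    refine ⟨h.1, isQPositive_smulRight hρ hQ hρQ, fun t ht => ?_⟩
    rw [resolvent_smulRight h_one ht, resolvent_smulRight hρQ ht]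
    have h_cp := isCP_smulRight hρ (hP.smul (inv_nonneg.mpr (Complex.zero_le_real.mpr hc.le)))
    convert h_cp.smul (by positivity : 0 ≤ 1 / (1 + t)) using 1
    ext A : 1
    simp [hQ_def, smul_sub]
  have hQ_scalar : ∃ a : ℂ, Q = a • (1 : Mat n) := by
    rcases (isQPure_iff.mp h).2 _ h_dom with h0 | ⟨s, hs, hs_eq⟩
    · exact ⟨0, by simpa [h_one] using LinearMap.congr_fun h0 1⟩
    · rw [resolvent_smulRight h_one hs] at hs_eq
      exact ⟨_, by simpa [h_one] using LinearMap.congr_fun hs_eq 1⟩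
  obtain ⟨a, ha⟩ := hQ_scalar
  have ha_one : a = 1 := by simpa [ha, h_one] using hρQ
  rw [ha_one, one_smul, hQ_def, sub_eq_self] at ha
  exact (smul_eq_zero_iff_right (inv_ne_zero hc')).mp ha

end SMulRight

/-! ### Lyapunov maps -/

section Lyapunov

variable {Y : Mat n}

/-- The Lyapunov map `A ↦ Y A + A Y*`, i.e. the part of a Lindblad generator without jump terms.
The `q`-pure maps that are invertible turn out to be the inverses of such maps. -/
def lyapunov (Y : Mat n) : Map n :=
  LinearMap.mulLeft ℂ Y + LinearMap.mulRight ℂ (star Y)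

lemma lyapunov_apply (Y A : Mat n) : lyapunov Y A = Y * A + A * star Y := rfl

lemma lyapunov_apply_one (Y : Mat n) : lyapunov Y 1 = Y + star Y := by
  rw [lyapunov_apply, mul_one, one_mul]

lemma lyapunov_apply_star (Y A : Mat n) : lyapunov Y (star A) = star (lyapunov Y A) := by
  simp only [lyapunov_apply, star_add, star_mul, star_star, add_comm]

lemma lyapunov_add_smul_one (Y : Mat n) (t : ℝ) :
    lyapunov Y + (t : ℂ) • 1 = lyapunov (Y + ((t / 2 : ℝ) : ℂ) • 1) := by
  ext A : 1
  simp only [lyapunov_apply, LinearMap.add_apply, LinearMap.smul_apply, Module.End.one_apply,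
    star_add, star_smul, star_one, RCLike.star_def, Complex.conj_ofReal, add_mul, mul_add,
    smul_mul_assoc, mul_smul_comm, one_mul, mul_one]
  rw [Complex.ofReal_div, Complex.ofReal_ofNat]
  module

lemma eq_zero_of_lyapunov_eq_zero (hY : (Y + star Y).PosDef) {A : Mat n}
    (hA : lyapunov Y A = 0) : A = 0 := by
  have h_self_adjoint (B : Mat n) (hB : IsSelfAdjoint B) (h0 : lyapunov Y B = 0) : B = 0 := by
    have hB_neg : lyapunov Y (-B) = 0 := by rw [map_neg, h0, neg_zero]
    exact eq_zero_of_posSemidef_of_neg_posSemidef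
      (posSemidef_of_mul_add_mul_conjTranspose hB hY (h0.symm ▸ PosSemidef.zero :
        (lyapunov Y B).PosSemidef))
      (posSemidef_of_mul_add_mul_conjTranspose hB.neg hY (hB_neg.symm ▸ PosSemidef.zero :
        (lyapunov Y (-B)).PosSemidef))
  have hA' : lyapunov Y (star A) = 0 := by rw [lyapunov_apply_star, hA, star_zero]
  have h_re : A + star A = 0 :=
    h_self_adjoint _ (IsSelfAdjoint.add_star_self A) (by rw [map_add, hA, hA', add_zero])
  have h_im : Complex.I • (A - star A) = 0 := by
    refine h_self_adjoint _ ?_ (by rw [map_smul, map_sub, hA, hA', sub_zero, smul_zero])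
    rw [IsSelfAdjoint, star_smul, star_sub, star_star, RCLike.star_def, Complex.conj_I, neg_smul,
      ← smul_neg, neg_sub]
  have h_im' : A - star A = 0 := (smul_eq_zero.mp h_im).resolve_left Complex.I_ne_zero
  calc A = (1 / 2 : ℂ) • ((A + star A) + (A - star A)) := by module
    _ = 0 := by rw [h_re, h_im', add_zero, smul_zero]

lemma isUnit_lyapunov (hY : (Y + star Y).PosDef) : IsUnit (lyapunov Y) := by
  have h_inj : Function.Injective (lyapunov Y) :=
    (injective_iff_map_eq_zero _).mpr fun _ => eq_zero_of_lyapunov_eq_zero hY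
  exact (Module.End.isUnit_iff _).mpr ⟨h_inj, LinearMap.injective_iff_surjective.mp h_inj⟩

open scoped Kronecker in
lemma choi_lyapunov_mul (Y : Mat n) (φ : Map n) : choi (lyapunov Y * φ) =
    (1 : Mat n) ⊗ₖ Y * choi φ + choi φ * ((1 : Mat n) ⊗ₖ Y)ᴴ := by
  ext ⟨i, k⟩ ⟨j, l⟩
  rw [choi_apply, Module.End.mul_apply, lyapunov_apply]
  simp only [Matrix.add_apply, mul_apply, Fintype.sum_prod_type]
  simp [one_apply, choi_apply, apply_ite]

open scoped Kronecker in
lemma isCP_inverse_lyapunov (hY : (Y + star Y).PosDef) : IsCP (Ring.inverse (lyapunov Y)) := by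
  have h_mul := Ring.mul_inverse_cancel _ (isUnit_lyapunov hY)
  set θ := Ring.inverse (lyapunov Y)
  have h_mul_apply (A : Mat n) : lyapunov Y (θ A) = A := LinearMap.congr_fun h_mul A
  have h_star (A : Mat n) : θ (star A) = star (θ A) := by
    rw [← sub_eq_zero]
    refine eq_zero_of_lyapunov_eq_zero hY ?_
    rw [map_sub, h_mul_apply, lyapunov_apply_star, h_mul_apply, sub_self]
  have h_add : (1 : Mat n) ⊗ₖ Y + ((1 : Mat n) ⊗ₖ Y)ᴴ = (1 : Mat n) ⊗ₖ (Y + star Y) := by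
    rw [conjTranspose_kronecker, conjTranspose_one, ← kronecker_add, star_eq_conjTranspose]
  refine isCP_of_posSemidef_choi (posSemidef_of_mul_add_mul_conjTranspose (isHermitian_choi h_star)
    (Z := (1 : Mat n) ⊗ₖ Y) (h_add ▸ PosDef.one.kronecker hY) ?_)
  rw [← choi_lyapunov_mul, h_mul]
  exact isCP_one.posSemidef_choi

lemma isQPositive_of_inv_eq_lyapunov {φ : (Map n)ˣ} (h : (↑φ⁻¹ : Map n) = lyapunov Y)
    (hY : (Y + star Y).PosDef) : IsQPositive (φ : Map n) := by
  have h_posDef {t : ℝ} (ht : 0 ≤ t) :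
      (Y + ((t / 2 : ℝ) : ℂ) • 1 + star (Y + ((t / 2 : ℝ) : ℂ) • 1)).PosDef := by
    have h_eq : Y + ((t / 2 : ℝ) : ℂ) • 1 + star (Y + ((t / 2 : ℝ) : ℂ) • 1) =
        Y + star Y + (t : ℂ) • 1 := by
      rw [star_add, star_smul, star_one, RCLike.star_def, Complex.conj_ofReal, Complex.ofReal_div,
        Complex.ofReal_ofNat]
      module
    exact h_eq ▸ hY.add_posSemidef (PosSemidef.one.smul (Complex.zero_le_real.mpr ht))
  refine ⟨noNegEigenvalue_iff.mpr fun t ht => ?_, fun t ht => ?_⟩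
  · rw [isUnit_one_add_smul_unit_iff, h, lyapunov_add_smul_one]
    exact isUnit_lyapunov (h_posDef ht)
  · rw [resolvent_unit, h, lyapunov_add_smul_one]
    exact isCP_inverse_lyapunov (h_posDef ht)

end Lyapunov

/-! ### The dissipative part of a map -/

section DissipativePart

variable {φ : Map n}

/-- The orthogonal projection of `ℂⁿ ⊗ ℂⁿ` onto the line of `∑ i, e_i ⊗ e_i`. -/
def vecOneProj (n : ℕ) : Matrix (Fin n × Fin n) (Fin n × Fin n) ℂ :=
  (n : ℂ)⁻¹ • vecMulVec (vec 1) (vec 1)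

lemma isHermitian_vecOneProj : (vecOneProj n).IsHermitian := by
  rw [IsHermitian, vecOneProj, conjTranspose_smul, conjTranspose_vecMulVec, star_vec_one, star_inv₀,
    star_natCast]

lemma vecOneProj_mulVec : vecOneProj n *ᵥ vec 1 = vec 1 := by
  obtain rfl | hn := eq_or_ne n 0
  · exact Subsingleton.elim _ _
  · rw [vecOneProj, smul_mulVec, vecMulVec_mulVec, vec_dotProduct_vec, transpose_one, mul_one,
      trace_one, Fintype.card_fin, op_smul_eq_smul, smul_smul,
      inv_mul_cancel₀ (Nat.cast_ne_zero.mpr hn), one_smul]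

lemma one_sub_vecOneProj_mulVec : (1 - vecOneProj n) *ᵥ vec 1 = 0 := by
  rw [sub_mulVec, one_mulVec, vecOneProj_mulVec, sub_self]

lemma vecMul_one_sub_vecOneProj : vec 1 ᵥ* (1 - vecOneProj n) = 0 := by
  have := congrArg star (one_sub_vecOneProj_mulVec (n := n))
  rwa [star_mulVec, star_vec_one, conjTranspose_sub, conjTranspose_one, isHermitian_vecOneProj.eq,
    star_zero] at this

/-- Compression of the Choi matrix to the orthogonal complement of `∑ i, e_i ⊗ e_i`. If `φ` is a
Lindblad generator `A ↦ θ A + lyapunov Y A` this removes the Lyapunov part, while it keeps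
complete positivity. -/
def dissipativePart : Map n →ₗ[ℂ] Map n :=
  choi.symm.toLinearMap ∘ₗ LinearMap.mulLeftRight ℂ (1 - vecOneProj n, 1 - vecOneProj n) ∘ₗ
    choi.toLinearMap

lemma choi_dissipativePart (φ : Map n) :
    choi (dissipativePart φ) = (1 - vecOneProj n) * choi φ * (1 - vecOneProj n) :=
  choi.apply_symm_apply _

lemma isCP_dissipativePart (h : IsCP φ) : IsCP (dissipativePart φ) := by
  refine isCP_of_posSemidef_choi ?_
  have := h.posSemidef_choi.mul_mul_conjTranspose_same (1 - vecOneProj n)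
  rwa [(isHermitian_one.sub isHermitian_vecOneProj).eq, ← choi_dissipativePart] at this

lemma choi_lyapunov (Y : Mat n) : choi (lyapunov Y) =
    vecMulVec (vec Y) (vec 1) + vecMulVec (vec 1) (star (vec Y)) := by
  ext ⟨i, k⟩ ⟨j, l⟩
  rw [choi_apply, lyapunov_apply]
  simp [vecMulVec_apply, mul_apply, single_apply, one_apply, ite_and, eq_comm]

lemma dissipativePart_lyapunov (Y : Mat n) : dissipativePart (lyapunov Y) = 0 := by
  apply choi.injective
  rw [choi_dissipativePart, choi_lyapunov, mul_add, add_mul, mul_vecMulVec, vecMulVec_mul,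
    vecMul_one_sub_vecOneProj, mul_vecMulVec, one_sub_vecOneProj_mulVec]
  simp

lemma dissipativePart_one : dissipativePart (1 : Map n) = 0 := by
  apply choi.injective
  rw [choi_dissipativePart, choi_one, mul_vecMulVec, one_sub_vecOneProj_mulVec, zero_vecMulVec,
    zero_mul, map_zero]

lemma exists_lyapunov_add_dissipativePart (h : ∀ A, φ (star A) = star (φ A)) :
    ∃ Y, lyapunov Y + dissipativePart φ = φ := by
  set C := choi φ with hC
  set Q := vecOneProj n with hQ
  have hQ_star : Qᴴ = Q := isHermitian_vecOneProj
  set X := (C - (1 / 2 : ℂ) • (Q * C)) * Q with hX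
  obtain ⟨Y, hY⟩ := vec_bijective.surjective
    ((C - (1 / 2 : ℂ) • (Q * C)) *ᵥ ((n : ℂ)⁻¹ • vec (1 : Mat n)))
  have hX_eq : vecMulVec (vec Y) (vec 1) = X := by
    rw [hY, ← mul_vecMulVec, smul_vecMulVec, hX, hQ, vecOneProj]
  have hX_star : vecMulVec (vec 1) (star (vec Y)) = Xᴴ := by
    rw [← hX_eq, conjTranspose_vecMulVec, star_vec_one]
  refine ⟨Y, choi.injective ?_⟩
  rw [map_add, choi_lyapunov, choi_dissipativePart, hX_eq, hX_star, hX, ← hQ, ← hC,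
    conjTranspose_mul, conjTranspose_sub, conjTranspose_smul, conjTranspose_mul, hQ_star,
    (isHermitian_choi h).eq]
  simp only [sub_mul, mul_sub, mul_one, one_mul, smul_mul_assoc, mul_smul_comm, ← mul_assoc,
    star_div₀, star_one, star_ofNat]
  module

/- A positive matrix `C` with `(1 - Q) C (1 - Q) = 0` satisfies `C (1 - Q) = 0`; so `C` is its
compression to the line of `∑ i, e_i ⊗ e_i`. -/
lemma IsCP.exists_smul_one_of_dissipativePart_eq_zero (h : IsCP φ) (h0 : dissipativePart φ = 0) :
    ∃ c : ℝ, 0 ≤ c ∧ φ = (c : ℂ) • 1 := by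
  set C := choi φ
  set Q := vecOneProj n with hQ
  have hP : (1 - Q)ᴴ = 1 - Q := isHermitian_one.sub isHermitian_vecOneProj
  have hPCP : (1 - Q) * C * (1 - Q) = 0 := by rw [← choi_dissipativePart, h0, map_zero]
  have hCP : C * (1 - Q) = 0 := ext_of_mulVec_single fun x => by
    rw [← mulVec_mulVec, zero_mulVec, ← h.posSemidef_choi.dotProduct_mulVec_zero_iff, star_mulVec,
      hP, ← dotProduct_mulVec, mulVec_mulVec, mulVec_mulVec, hPCP, zero_mulVec, dotProduct_zero]
  have hCQ : C * Q = C := by rwa [mul_sub, mul_one, sub_eq_zero, eq_comm] at hCP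
  have hQC : Q * C = C := by
    have := congrArg conjTranspose hCQ
    rwa [conjTranspose_mul, h.posSemidef_choi.isHermitian.eq, isHermitian_vecOneProj.eq] at this
  have h_coeff : 0 ≤ (n : ℂ)⁻¹ ^ 2 * (vec 1 ⬝ᵥ (C *ᵥ vec 1)) := by
    have := h.posSemidef_choi.dotProduct_mulVec_nonneg (vec 1)
    rw [star_vec_one] at this
    exact mul_nonneg (pow_nonneg (inv_nonneg.mpr (Nat.cast_nonneg n)) 2) this
  refine ⟨_, (Complex.le_def.mp h_coeff).1, choi.injective ?_⟩
  rw [← Complex.eq_re_of_ofReal_le (r := 0) h_coeff, map_smul, choi_one]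
  calc C = Q * C * Q := by rw [hQC, hCQ]
    _ = _ := by
      rw [hQ, vecOneProj, smul_mul_assoc, smul_mul_assoc, mul_smul_comm, smul_smul, mul_assoc,
        mul_vecMulVec, vecMulVec_mul_vecMulVec, vecMulVec_smul, smul_smul, ← sq]

end DissipativePart

/-! ### Invertible maps -/

section Invertible

variable {φ ψ : (Map n)ˣ}

lemma inv_apply_one (h1 : (φ : Map n) 1 = 1) : (↑φ⁻¹ : Map n) 1 = 1 := by
  conv_lhs => rw [← h1]
  rw [← Module.End.mul_apply, Units.inv_mul, Module.End.one_apply]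

lemma inv_apply_star (h : ∀ A, (φ : Map n) (star A) = star ((φ : Map n) A)) (A : Mat n) :
    (↑φ⁻¹ : Map n) (star A) = star ((↑φ⁻¹ : Map n) A) := by
  have h_inv (B : Mat n) : (φ : Map n) ((↑φ⁻¹ : Map n) B) = B :=
    LinearMap.congr_fun φ.mul_inv B
  have h_inv' (B : Mat n) : (↑φ⁻¹ : Map n) ((φ : Map n) B) = B :=
    LinearMap.congr_fun φ.inv_mul B
  conv_lhs => rw [← h_inv A, ← h, h_inv']

lemma resolvent_unit_mul {t : ℝ} (h : IsUnit (1 + (t : ℂ) • (φ : Map n))) :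
    resolvent (φ : Map n) t * ((↑φ⁻¹ : Map n) + (t : ℂ) • 1) = 1 := by
  rw [resolvent_unit, Ring.inverse_mul_cancel _ (isUnit_one_add_smul_unit_iff.mp h)]

lemma resolvent_unit_sub_resolvent_unit {t : ℝ} (hφ : IsUnit (1 + (t : ℂ) • (φ : Map n)))
    (hψ : IsUnit (1 + (t : ℂ) • (ψ : Map n))) :
    resolvent (φ : Map n) t - resolvent (ψ : Map n) t = resolvent (φ : Map n) t *
      ((↑ψ⁻¹ : Map n) - (↑φ⁻¹ : Map n)) * resolvent (ψ : Map n) t := by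
  rw [resolvent_unit, resolvent_unit, Ring.inverse_sub_inverse (iff_of_true
    (isUnit_one_add_smul_unit_iff.mp hφ) (isUnit_one_add_smul_unit_iff.mp hψ)),
    add_sub_add_right_eq_sub]

lemma qDominates_of_isCP_inv_sub_inv (hφ : IsQPositive (φ : Map n)) (hψ : IsQPositive (ψ : Map n))
    (h : IsCP ((↑ψ⁻¹ : Map n) - (↑φ⁻¹ : Map n))) :
    QDominates (φ : Map n) (ψ : Map n) := by
  refine ⟨hφ, hψ, fun t ht => ?_⟩
  rw [resolvent_unit_sub_resolvent_unit (hφ.isUnit ht) (hψ.isUnit ht)]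
  exact ((hφ.isCP_resolvent ht).mul h).mul (hψ.isCP_resolvent ht)

lemma smul_smul_resolvent_unit_sub {t : ℝ} (h : IsUnit (1 + (t : ℂ) • (φ : Map n))) :
    (t : ℂ) • (t : ℂ) • resolvent (φ : Map n) t - (t : ℂ) • 1 =
      resolvent (φ : Map n) t * ((↑φ⁻¹ : Map n) * (↑φ⁻¹ : Map n)) -
        (↑φ⁻¹ : Map n) := by
  set T := (↑φ⁻¹ : Map n)
  set R := resolvent (φ : Map n) t
  have hR : R * T = 1 - (t : ℂ) • R := by
    rw [eq_sub_iff_add_eq, ← resolvent_unit_mul h, mul_add, mul_smul_comm, mul_one]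
  rw [← mul_assoc, hR, sub_mul, one_mul, smul_mul_assoc, hR, smul_sub]
  abel

lemma tendsto_choi_smul_smul_resolvent_unit_sub {Φ : Map n} (h : QDominates Φ φ) (h1 : Φ 1 = 1) :
    Tendsto (fun t : ℝ => choi ((t : ℂ) • (t : ℂ) • resolvent (φ : Map n) t - (t : ℂ) • 1)) atTop
      (𝓝 (choi (-(↑φ⁻¹ : Map n)))) := by
  set T := (↑φ⁻¹ : Map n)
  have h_mul := tendsto_choi_map (LinearMap.mulRight ℂ (T * T)) (h.tendsto_choi_resolvent h1)
  have h_sub := h_mul.sub (tendsto_const_nhds (x := choi T))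
  simp only [← map_sub, LinearMap.mulRight_apply, zero_mul, zero_sub] at h_sub
  refine h_sub.congr' ?_
  filter_upwards [eventually_ge_atTop 0] with t ht
  rw [smul_smul_resolvent_unit_sub (h.2.1.isUnit ht)]

/- `t² φ (1 + t φ)⁻¹ - t` tends to `-φ⁻¹`, and its dissipative part does not see the term `t`. -/
lemma QDominates.isCP_dissipativePart_neg_inv {Φ : Map n} (h : QDominates Φ φ) (h1 : Φ 1 = 1) :
    IsCP (dissipativePart (-(↑φ⁻¹ : Map n))) := by
  refine isCP_of_tendsto_choi
    (tendsto_choi_map dissipativePart (tendsto_choi_smul_smul_resolvent_unit_sub h h1)) ?_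
  filter_upwards [eventually_ge_atTop 0] with t ht
  have h_eq : dissipativePart ((t : ℂ) • (t : ℂ) • resolvent (φ : Map n) t - (t : ℂ) • 1) =
      (t : ℂ) • (t : ℂ) • dissipativePart (resolvent (φ : Map n) t) := by
    rw [map_sub, map_smul, map_smul, map_smul, dissipativePart_one, smul_zero, sub_zero]
  rw [h_eq]
  exact ((isCP_dissipativePart (h.2.1.isCP_resolvent ht)).smul ht).smul ht

lemma QDominates.isCP_inv_sub_inv (h : QDominates (φ : Map n) (ψ : Map n))
    (h1 : (φ : Map n) 1 = 1) :
    IsCP ((↑ψ⁻¹ : Map n) - (↑φ⁻¹ : Map n)) := by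
  have h_sub := (tendsto_choi_smul_smul_resolvent_unit_sub h.1.qDominates_self h1).sub
    (tendsto_choi_smul_smul_resolvent_unit_sub h h1)
  rw [← map_sub, neg_sub_neg] at h_sub
  have h_eq (t : ℝ) : choi ((t : ℂ) • (t : ℂ) • resolvent (φ : Map n) t - (t : ℂ) • 1) -
      choi ((t : ℂ) • (t : ℂ) • resolvent (ψ : Map n) t - (t : ℂ) • 1) =
      choi ((t : ℂ) • (t : ℂ) • (resolvent (φ : Map n) t - resolvent (ψ : Map n) t)) := by
    rw [← map_sub, sub_sub_sub_cancel_right]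
    simp only [smul_sub]
  refine isCP_of_tendsto_choi (h_sub.congr h_eq) ?_
  filter_upwards [eventually_ge_atTop 0] with t ht using ((h.2.2 t ht).smul ht).smul ht

end Invertible

section InvertiblePure

variable {φ : (Map n)ˣ} {Y : Mat n}

/- If the dissipative part `-S` of `φ⁻¹` were nonzero, then `φ⁻¹ + S` would be the inverse of
another subordinate. -/
lemma IsQPure.exists_inv_eq_lyapunov (h : IsQPure (φ : Map n)) (h1 : (φ : Map n) 1 = 1) :
    ∃ Y, (↑φ⁻¹ : Map n) = lyapunov Y := by
  obtain ⟨hφ, h_pure⟩ := isQPure_iff.mp h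
  set S := dissipativePart (-(↑φ⁻¹ : Map n)) with hS_def
  have hS : IsCP S := hφ.qDominates_self.isCP_dissipativePart_neg_inv h1
  obtain ⟨Y, hY⟩ := exists_lyapunov_add_dissipativePart (inv_apply_star hφ.isCP.map_star)
  replace hY : lyapunov Y = ↑φ⁻¹ + S := by
    rw [hS_def, map_neg, ← sub_eq_add_neg, eq_sub_iff_add_eq, hY]
  have hY_posDef : (Y + star Y).PosDef := by
    rw [← lyapunov_apply_one, hY, LinearMap.add_apply, inv_apply_one h1]
    exact PosDef.one.add_posSemidef (hS.posSemidef PosSemidef.one)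
  obtain ⟨u, hu⟩ := isUnit_lyapunov hY_posDef
  have h_dom : QDominates (φ : Map n) (↑u⁻¹ : Map n) := by
    refine qDominates_of_isCP_inv_sub_inv hφ
      (isQPositive_of_inv_eq_lyapunov (by rw [inv_inv, hu]) hY_posDef) ?_
    rwa [inv_inv, hu, hY, add_sub_cancel_left]
  rcases h_pure _ h_dom with h0 | ⟨s, hs, hs_eq⟩
  · have : Subsingleton (Map n) :=
      subsingleton_of_zero_eq_one (isUnit_zero_iff.mp (h0 ▸ u⁻¹.isUnit))
    exact ⟨0, Subsingleton.elim _ _⟩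
  · have hu_eq : (u : Map n) = ↑φ⁻¹ + (s : ℂ) • 1 := by
      rw [← Units.mul_right_inj u⁻¹, Units.inv_mul, hs_eq, resolvent_unit_mul (hφ.isUnit hs)]
    refine ⟨Y + ((-s / 2 : ℝ) : ℂ) • 1, ?_⟩
    rw [← lyapunov_add_smul_one, ← hu, hu_eq, add_assoc, ← add_smul, Complex.ofReal_neg,
      add_neg_cancel, zero_smul, add_zero]

lemma IsCP.eq_zero_of_neg {θ : Map n} (h : IsCP θ) (h' : IsCP (-θ)) : θ = 0 := by
  refine choi.map_eq_zero_iff.mp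
    (eq_zero_of_posSemidef_of_neg_posSemidef h.posSemidef_choi ?_)
  rw [← map_neg]
  exact h'.posSemidef_choi

lemma QDominates.eq_zero_or_isUnit {ψ : Map n} (h : QDominates (φ : Map n) ψ)
    (h1 : (φ : Map n) 1 = 1) : ψ = 0 ∨ IsUnit ψ := by
  obtain ⟨L, hL⟩ := h.exists_isResolventLimit h1
  have hL_cp : IsCP L := hL.isCP h.2.1
  have h_sub_cp : IsCP (1 - L) := by
    refine hL.isCP_sub h ?_
    rw [← φ.mul_inv]
    exact h.1.tendsto_choi_smul_resolvent h1 (by rw [mul_assoc, Units.mul_inv, mul_one])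
  have hL_diss : dissipativePart L = 0 := by
    refine (isCP_dissipativePart hL_cp).eq_zero_of_neg ?_
    have := isCP_dissipativePart h_sub_cp
    rwa [map_sub, dissipativePart_one, zero_sub] at this
  obtain ⟨c, -, hc⟩ := hL_cp.exists_smul_one_of_dissipativePart_eq_zero hL_diss
  have h_smul : (c : ℂ) • L = (1 : ℂ) • L := calc
    (c : ℂ) • L = (c : ℂ) • 1 * L := by rw [smul_mul_assoc, one_mul]
    _ = (1 : ℂ) • L := by rw [← hc, hL.mul_self h h1, one_smul]
  by_cases hL0 : L = 0
  · left
    rw [← hL.mul_eq_right h h1, hL0, zero_mul]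
  · right
    obtain rfl : L = 1 := by rw [hc, smul_left_injective ℂ hL0 h_smul, one_smul]
    exact hL.isUnit h.2.1

theorem isQPure_of_inv_eq_lyapunov (h : (↑φ⁻¹ : Map n) = lyapunov Y) (hY : Y + star Y = 1) :
    IsQPure (φ : Map n) := by
  have hφ : IsQPositive (φ : Map n) := isQPositive_of_inv_eq_lyapunov h (hY ▸ PosDef.one)
  have h1 : (φ : Map n) 1 = 1 := by
    rw [← inv_inv φ]
    exact inv_apply_one (by rw [h, lyapunov_apply_one, hY])
  refine isQPure_iff.mpr ⟨hφ, fun ψ hψ => (hψ.eq_zero_or_isUnit h1).imp_right ?_⟩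
  rintro ⟨ψ, rfl⟩
  set D : Map n := ↑ψ⁻¹ - ↑φ⁻¹ with hD_def
  have hD : IsCP D := hψ.isCP_inv_sub_inv h1
  have hD_diss : dissipativePart D = 0 := by
    refine (isCP_dissipativePart hD).eq_zero_of_neg ?_
    have := hψ.isCP_dissipativePart_neg_inv h1
    rwa [map_neg, ← sub_zero (dissipativePart _), ← dissipativePart_lyapunov Y, ← h,
      ← map_sub] at this
  obtain ⟨c, hc, hDc⟩ := hD.exists_smul_one_of_dissipativePart_eq_zero hD_diss
  have hψ_inv : (↑ψ⁻¹ : Map n) = ↑φ⁻¹ + (c : ℂ) • 1 := by rw [← hDc, hD_def, add_sub_cancel]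
  exact ⟨c, hc, by rw [resolvent_unit, ← hψ_inv, Ring.inverse_unit, inv_inv]⟩

end InvertiblePure

section PhaseMatrix

variable {d : Fin n → ℝ}

/-- The matrix with entries `1 / (1 + i (d_i - d_j))`. Its Schur map is the normal form, up to
unitary conjugation, of an invertible unital `q`-pure map. -/
def phaseMatrix (d : Fin n → ℝ) : Mat n :=
  of fun i j => 1 / (1 + Complex.I * ((d i - d j : ℝ) : ℂ))

lemma phaseMatrix_fin_two (d : Fin 2 → ℝ) : phaseMatrix d =
    !![1, 1 / (1 + Complex.I * ((d 0 - d 1 : ℝ) : ℂ));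
      1 / (1 - Complex.I * ((d 0 - d 1 : ℝ) : ℂ)), 1] := by
  ext i j
  fin_cases i <;> fin_cases j <;>
    simp [phaseMatrix, ← mul_neg, sub_eq_add_neg, -mul_eq_mul_left_iff]

lemma schurMap_apply (M A : Mat n) (i j : Fin n) : schurMap M A i j = M i j * A i j := rfl

lemma lyapunov_diagonal_apply (y : Fin n → ℂ) (A : Mat n) (i j : Fin n) :
    lyapunov (diagonal y) A i j = (y i + star (y j)) * A i j := by
  rw [lyapunov_apply, star_eq_conjTranspose, diagonal_conjTranspose, Matrix.add_apply,
    diagonal_mul, mul_diagonal, Pi.star_apply]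
  ring

lemma schurMap_phaseMatrix_mul_lyapunov (d : Fin n → ℝ) : schurMap (phaseMatrix d) *
    lyapunov (diagonal fun i => 1 / 2 + Complex.I * (d i : ℂ)) = 1 := by
  ext A i j
  have h_ne : 1 + Complex.I * ((d i - d j : ℝ) : ℂ) ≠ 0 := fun h => by
    simpa using congrArg Complex.re h
  have h_sum : 1 / 2 + Complex.I * (d i : ℂ) + star (1 / 2 + Complex.I * (d j : ℂ)) =
      1 + Complex.I * ((d i - d j : ℝ) : ℂ) := by
    simp only [star_add, star_div₀, star_one, star_ofNat, star_mul', RCLike.star_def,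
      Complex.conj_I, Complex.conj_ofReal, Complex.ofReal_sub]
    ring
  rw [Module.End.mul_apply, Module.End.one_apply, schurMap_apply, lyapunov_diagonal_apply, h_sum,
    phaseMatrix, of_apply, one_div, inv_mul_cancel_left₀ h_ne]

/-- The Schur map of `phaseMatrix d`, bundled with its Lyapunov inverse. -/
def phaseSchurMap (d : Fin n → ℝ) : (Map n)ˣ where
  val := schurMap (phaseMatrix d)
  inv := lyapunov (diagonal fun i => 1 / 2 + Complex.I * (d i : ℂ))
  val_inv := schurMap_phaseMatrix_mul_lyapunov d
  inv_val := mul_eq_one_comm.mp (schurMap_phaseMatrix_mul_lyapunov d)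

theorem isQPure_schurMap_phaseMatrix (d : Fin n → ℝ) : IsQPure (schurMap (phaseMatrix d)) := by
  refine isQPure_of_inv_eq_lyapunov (φ := phaseSchurMap d)
    (Y := diagonal fun i => 1 / 2 + Complex.I * (d i : ℂ)) rfl ?_
  rw [star_eq_conjTranspose, diagonal_conjTranspose, diagonal_add, ← diagonal_one]
  congr 1 with i
  simp only [Pi.star_apply, star_add, star_div₀, star_one, star_ofNat, star_mul', RCLike.star_def,
    Complex.conj_I, Complex.conj_ofReal]
  ring

lemma exists_eq_unitaryConj_diagonal {H : Mat n} (hH : H.IsHermitian) :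
    ∃ (U : unitaryGroup (Fin n) ℂ) (d : Fin n → ℝ),
      H = (unitaryConj U : Map n) (diagonal fun i => (d i : ℂ)) :=
  ⟨hH.eigenvectorUnitary, hH.eigenvalues, hH.spectral_theorem⟩

lemma lyapunov_unitaryConj (U : unitaryGroup (Fin n) ℂ) (Y : Mat n) :
    lyapunov ((unitaryConj U : Map n) Y) =
      unitaryConj U * lyapunov Y * ↑(unitaryConj U)⁻¹ := by
  have h_star_mul : star (U : Mat n) * U = 1 := Unitary.coe_star_mul_self U
  rw [Units.eq_mul_inv_iff_mul_eq]
  ext A : 1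
  simp only [Module.End.mul_apply, lyapunov_apply, unitaryConj_apply, star_mul, star_star, mul_add,
    add_mul, mul_assoc, ← mul_assoc (star (U : Mat n)) U, h_star_mul, one_mul]

theorem IsQPure.exists_isConjugateTo_phaseMatrix {φ : (Map n)ˣ} (h : IsQPure (φ : Map n))
    (h1 : (φ : Map n) 1 = 1) : ∃ d, IsConjugateTo (φ : Map n) (schurMap (phaseMatrix d)) := by
  obtain ⟨Y, hY⟩ := h.exists_inv_eq_lyapunov h1
  have hY_one : Y + star Y = 1 := by rw [← lyapunov_apply_one, ← hY, inv_apply_one h1]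
  have hH : ((-Complex.I) • (Y - (1 / 2 : ℂ) • 1)).IsHermitian := by
    rw [IsHermitian, ← star_eq_conjTranspose, star_smul, star_sub, star_smul, star_one,
      eq_sub_of_add_eq' hY_one, RCLike.star_def, map_neg, Complex.conj_I, neg_neg, map_div₀,
      map_one, map_ofNat]
    module
  obtain ⟨U, d, hd⟩ := exists_eq_unitaryConj_diagonal hH
  have hY_diag : Y = (unitaryConj U : Map n) (diagonal fun i => 1 / 2 + Complex.I * (d i : ℂ)) := by
    have h_split : (diagonal fun i => 1 / 2 + Complex.I * (d i : ℂ) : Mat n) =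
        (1 / 2 : ℂ) • 1 + Complex.I • diagonal fun i => (d i : ℂ) := by
      rw [← diagonal_one, ← diagonal_smul, ← diagonal_smul, diagonal_add]
      simp
    rw [h_split, map_add, map_smul, map_smul, unitaryConj_apply_one, ← hd, smul_smul, mul_neg,
      Complex.I_mul_I]
    module
  have h_inv : φ⁻¹ = unitaryConj U * (phaseSchurMap d)⁻¹ * (unitaryConj U)⁻¹ :=
    Units.ext (by rw [hY, hY_diag, lyapunov_unitaryConj]; rfl)
  refine ⟨d, isConjugateTo_iff.mpr ⟨U, ?_⟩⟩
  rw [← inv_inv φ, h_inv, _root_.mul_inv_rev, _root_.mul_inv_rev, inv_inv, inv_inv, ← mul_assoc]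
  rfl

end PhaseMatrix

/-! ### Maps between diagonal matrices -/

section DiagMap

/-- The map `A ↦ diag (C (diag A))` that reads off the diagonal of `A`, applies `C` to it, and
returns a diagonal matrix. In particular `diagMap 1` is the conditional expectation onto the
diagonal matrices. -/
def diagMap : Mat n →ₙₐ[ℂ] Map n where
  toFun C := diagonalLinearMap (Fin n) ℂ ℂ ∘ₗ C.mulVecLin ∘ₗ diagLinearMap (Fin n) ℂ ℂ
  map_smul' c C := LinearMap.ext fun A => by simp [← diagonal_smul]
  map_zero' := LinearMap.ext fun A => by simp
  map_add' C D := LinearMap.ext fun A => by simp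
  map_mul' C D := LinearMap.ext fun A => by
    change diagonal ((C * D) *ᵥ A.diag) = diagonal (C *ᵥ (diagonal (D *ᵥ A.diag)).diag)
    rw [diag_diagonal, mulVec_mulVec]

lemma diagMap_apply (C A : Mat n) : diagMap C A = diagonal (C *ᵥ A.diag) := rfl

lemma choi_diagMap (C : Mat n) :
    choi (diagMap C) = diagonal fun x : Fin n × Fin n => C x.2 x.1 := by
  ext ⟨i, k⟩ ⟨j, l⟩
  rw [choi_apply, diagMap_apply]
  obtain rfl | hij := eq_or_ne i j
  · simp [diagonal_apply, diag_single_same]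
  · simp [hij, diag_single_of_ne]

lemma isCP_diagMap_iff {C : Mat n} : IsCP (diagMap C) ↔ ∀ i j, 0 ≤ C i j := by
  rw [isCP_iff_posSemidef_choi, choi_diagMap, posSemidef_diagonal_iff, Prod.forall, forall_comm]

lemma eq_diagMap_of_mul_diagMap_one {φ : Map n} (h_left : diagMap 1 * φ = φ)
    (h_right : φ * diagMap 1 = φ) : φ = diagMap (of fun i j => φ (single j j 1) i i) := by
  ext A : 1
  calc φ A = diagMap 1 (φ (diagMap 1 A)) := by
        rw [← Module.End.mul_apply, ← Module.End.mul_apply, mul_assoc, h_right, h_left]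
    _ = diagonal (φ (diagonal A.diag)).diag := by simp only [diagMap_apply, one_mulVec]
    _ = diagMap (of fun i j => φ (single j j 1) i i) A := by
        rw [diagMap_apply]
        congr 1 with i
        simp [map_apply_eq_sum_choi φ (diagonal _), choi_apply, mulVec, dotProduct, diagonal_apply,
          mul_comm]

variable {a b : ℝ}

/-- The transition matrix of the two-state Markov chain that leaves the first state with
probability `a` and the second one with probability `b`. -/
def twoStateMatrix (a b : ℝ) : Mat 2 := !![1 - (a : ℂ), (a : ℂ); (b : ℂ), 1 - (b : ℂ)]

lemma exists_eq_twoStateMatrix {C : Mat 2} (h : IsCP (diagMap C)) (h1 : diagMap C 1 = 1) :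
    ∃ a b : ℝ, 0 ≤ a ∧ 0 ≤ b ∧ C = twoStateMatrix a b := by
  rw [isCP_diagMap_iff] at h
  have h_row : ∀ i, C i 0 + C i 1 = 1 := by
    simpa [diagMap_apply, ← diagonal_one, funext_iff, mulVec, dotProduct] using h1
  refine ⟨(C 0 1).re, (C 1 0).re, (Complex.nonneg_iff.mp (h 0 1)).1,
    (Complex.nonneg_iff.mp (h 1 0)).1, ?_⟩
  rw [twoStateMatrix, ← Complex.eq_re_of_ofReal_le (r := 0) (by simpa using h 0 1),
    ← Complex.eq_re_of_ofReal_le (r := 0) (by simpa using h 1 0), ← eq_sub_of_add_eq (h_row 0),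
    ← eq_sub_of_add_eq' (h_row 1), ← eta_fin_two]

lemma diagMap_twoStateMatrix_one (a b : ℝ) : diagMap (twoStateMatrix a b) 1 = 1 := by
  rw [diagMap_apply, ← diagonal_one]
  congr 1 with i
  fin_cases i <;> simp [twoStateMatrix, mulVec, dotProduct]

lemma add_le_one_of_noNegEigenvalue (h : NoNegEigenvalue (diagMap (twoStateMatrix a b))) :
    a + b ≤ 1 := by
  by_contra! hab
  have h_eigenvector : Module.End.HasEigenvector (diagMap (twoStateMatrix a b))
      ((1 - (a + b) : ℝ) : ℂ) (diagonal ![(a : ℂ), -(b : ℂ)]) := by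
    refine ⟨Module.End.mem_eigenspace_iff.mpr ?_, fun h0 => ?_⟩
    · rw [diagMap_apply, diag_diagonal, ← diagonal_smul]
      congr 1 with i
      fin_cases i <;> simp [twoStateMatrix] <;> ring
    · have ha : a = 0 := by simpa using congrFun (congrFun h0 0) 0
      have hb : b = 0 := by simpa using congrFun (congrFun h0 1) 1
      linarith
  exact h _ (sub_neg.mpr hab) (Module.End.hasEigenvalue_of_hasEigenvector h_eigenvector)

/- By the Cayley–Hamilton theorem, `C (1 + t C)⁻¹ = (C + t det C) / det (1 + t C)`. -/
lemma resolvent_diagMap {C : Mat 2} {t : ℝ} (hu : IsUnit (1 + (t : ℂ) • diagMap C))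
    (hC : (1 + (t : ℂ) • C).det ≠ 0) : resolvent (diagMap C) t =
      diagMap ((1 + (t : ℂ) • C).det⁻¹ • (C + ((t : ℂ) * C.det) • 1)) := by
  rw [resolvent_eq_iff hu, mul_add, mul_one, mul_smul_comm, ← map_mul, ← map_smul, ← map_add]
  congr 1
  rw [smul_mul_assoc, smul_comm, ← smul_add, inv_smul_eq_iff₀ hC]
  ext i j
  fin_cases i <;> fin_cases j <;> simp [det_fin_two, mul_apply] <;> ring

lemma det_twoStateMatrix (a b : ℝ) : (twoStateMatrix a b).det = ((1 - (a + b) : ℝ) : ℂ) := by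
  rw [twoStateMatrix, det_fin_two_of]
  push_cast
  ring

lemma det_one_add_smul_twoStateMatrix (a b t : ℝ) : (1 + (t : ℂ) • twoStateMatrix a b).det =
    (((1 + t) * (1 + t * (1 - (a + b))) : ℝ) : ℂ) := by
  simp [twoStateMatrix, det_fin_two]
  ring

lemma resolvent_twoStateMatrix {t : ℝ} (hu : IsUnit (1 + (t : ℂ) • diagMap (twoStateMatrix a b)))
    (ht : (1 + t) * (1 + t * (1 - (a + b))) ≠ 0) : resolvent (diagMap (twoStateMatrix a b)) t =
      diagMap ((((1 + t) * (1 + t * (1 - (a + b))))⁻¹ : ℝ) •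
        (twoStateMatrix a b + (t * (1 - (a + b)) : ℝ) • 1)) := by
  have h_det := det_one_add_smul_twoStateMatrix a b t
  rw [resolvent_diagMap hu (h_det ▸ Complex.ofReal_ne_zero.mpr ht), h_det, det_twoStateMatrix,
    ← Complex.ofReal_inv, ← Complex.ofReal_mul, Complex.coe_smul, Complex.coe_smul]

lemma diagMap_single_mul_self (d : ℝ) : diagMap (single (1 : Fin 2) 1 (d : ℂ)) *
    diagMap (single 1 1 (d : ℂ)) = (d : ℂ) • diagMap (single 1 1 (d : ℂ)) := by
  rw [← map_mul, ← map_smul, single_mul_single_same, smul_single, smul_eq_mul]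

lemma qDominates_diagMap_single (h : IsQPositive (diagMap (twoStateMatrix a b))) (ha : 0 ≤ a)
    (hb : 0 ≤ b) (hab : a + b < 1) : QDominates (diagMap (twoStateMatrix a b))
      (diagMap (single 1 1 (((1 - (a + b)) / (1 - a) : ℝ) : ℂ))) := by
  set d := (1 - (a + b)) / (1 - a) with hd
  have ha1 : 0 < 1 - a := by linarith
  have hm : 0 < 1 - (a + b) := by linarith
  have hd0 : 0 < d := div_pos hm ha1
  have h_cp : IsCP (diagMap (single (1 : Fin 2) 1 (d : ℂ))) := isCP_diagMap_iff.mpr fun i j => by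
    fin_cases i <;> fin_cases j <;> simp [hd0.le]
  refine ⟨h, h_cp.isQPositive_of_mul_self hd0.le (diagMap_single_mul_self d), fun t ht => ?_⟩
  have h_det : 0 < (1 + t) * (1 + t * (1 - (a + b))) := by positivity
  have h_entry : 1 / (1 + t * d) * d ≤
      ((1 + t) * (1 + t * (1 - (a + b))))⁻¹ * (1 - b + t * (1 - (a + b))) := by
    have h_left : 1 / (1 + t * d) * d = (1 - (a + b)) / (1 - a + t * (1 - (a + b))) := by
      rw [hd]
      field_simp
    rw [h_left, inv_mul_eq_div, div_le_div_iff₀ (by positivity) h_det]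
    nlinarith [mul_nonneg ha hb]
  have h_resolvent := resolvent_twoStateMatrix (h.isUnit ht) h_det.ne'
  have h_nonneg := isCP_diagMap_iff.mp (h_resolvent ▸ h.isCP_resolvent ht)
  rw [h_resolvent, resolvent_of_mul_self (diagMap_single_mul_self d) (by positivity), ← map_smul,
    ← map_sub, isCP_diagMap_iff]
  intro i j
  by_cases hij : 1 = i ∧ 1 = j
  · obtain ⟨rfl, rfl⟩ := hij
    rw [Matrix.sub_apply, sub_nonneg]
    convert Complex.real_le_real.mpr h_entry using 1 <;> simp [twoStateMatrix, mul_add]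
  · simpa [single_apply_of_ne _ _ _ _ _ hij] using h_nonneg i j

lemma not_isQPure_diagMap_twoStateMatrix (ha : 0 ≤ a) (hb : 0 ≤ b) (hab : a + b ≠ 1) :
    ¬ IsQPure (diagMap (twoStateMatrix a b)) := by
  rw [isQPure_iff]
  rintro ⟨hq, h_pure⟩
  have h_lt : a + b < 1 := lt_of_le_of_ne (add_le_one_of_noNegEigenvalue hq.1) hab
  have h_apply_one (d : ℝ) : diagMap (single (1 : Fin 2) 1 (d : ℂ)) 1 = diagonal ![0, (d : ℂ)] := by
    rw [diagMap_apply]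
    congr 1 with i
    fin_cases i <;> simp
  rcases h_pure _ (qDominates_diagMap_single hq ha hb h_lt) with h_eq | ⟨s, hs, h_eq⟩
  · have h_apply := congrFun (congrFun (LinearMap.congr_fun h_eq 1) 1) 1
    rw [h_apply_one] at h_apply
    have h_ne : (1 - (a + b)) / (1 - a) ≠ 0 :=
      div_ne_zero (by linarith) (by linarith)
    exact h_ne (Complex.ofReal_eq_zero.mp (by simpa using h_apply))
  · have h_apply := congrFun (congrFun (LinearMap.congr_fun h_eq 1) 0) 0
    rw [h_apply_one, resolvent_apply_one (hq.isUnit hs) (diagMap_twoStateMatrix_one a b) hs]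
      at h_apply
    have h_ne : 1 / (1 + s) ≠ 0 := by positivity
    exact h_ne (Complex.ofReal_eq_zero.mp (by simpa [Matrix.smul_apply] using h_apply.symm))

end DiagMap

/-! ### The dichotomy on `M₂` -/

section Dichotomy

lemma IsCP.apply_eq_mul {φ : Map n} (h : IsCP φ) (hφ : ∀ i, φ (single i i 1) = single i i 1)
    (A : Mat n) (i j : Fin n) : φ A i j = A i j * φ (single i j 1) i j := by
  have h_diag {i k : Fin n} (hik : i ≠ k) : choi φ (i, k) (i, k) = 0 := by
    simp [choi_apply, hφ, hik]
  have h_left {k l i j : Fin n} (hik : i ≠ k) : choi φ (i, k) (j, l) = 0 :=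
    apply_eq_zero_of_posSemidef_of_diag_left h.posSemidef_choi (h_diag hik) _
  have h_right {k l i j : Fin n} (hjl : j ≠ l) : choi φ (i, k) (j, l) = 0 :=
    apply_eq_zero_of_posSemidef_of_diag_right h.posSemidef_choi (h_diag hjl) _
  rw [map_apply_eq_sum_choi, Finset.sum_eq_single i, Finset.sum_eq_single j, choi_apply]
  · exact fun l _ hl => by rw [h_right hl, mul_zero]
  · simp
  · exact fun k _ hk => Finset.sum_eq_zero fun l _ => by rw [h_left hk, mul_zero]
  · simp

lemma IsCP.eq_one_or_eq_diagMap_one {L : Map 2} (h : IsCP L) (h_idem : L * L = L)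
    (hL : ∀ i, L (single i i 1) = single i i 1) : L = 1 ∨ L = diagMap 1 := by
  have h_schur := h.apply_eq_mul hL
  set c := L (single 0 1 1) 0 1
  have h_diag (A : Mat 2) (i : Fin 2) : L A i i = A i i := by
    rw [h_schur, hL, single_apply_same, mul_one]
  have h01 (A : Mat 2) : L A 0 1 = A 0 1 * c := h_schur A 0 1
  have h10 (A : Mat 2) : L A 1 0 = A 1 0 * star c := by
    have h_star : single 1 0 (1 : ℂ) = star (single 0 1 (1 : ℂ) : Mat 2) := by
      rw [star_eq_conjTranspose, conjTranspose_single, star_one]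
    rw [h_schur, h_star, h.map_star, star_apply]
  have hc : c * c = c := by
    have := congrFun (congrFun (LinearMap.congr_fun h_idem (single 0 1 1)) 0) 1
    rwa [Module.End.mul_apply, h01] at this
  rcases IsIdempotentElem.iff_eq_zero_or_one.mp hc with hc0 | hc1
  · right
    ext A i j
    fin_cases i <;> fin_cases j <;> simp [diagMap_apply, h_diag, h01, h10, hc0]
  · left
    ext A i j
    fin_cases i <;> fin_cases j <;> simp [h_diag, h01, h10, hc1]

lemma IsQPositive.isUnit_or_eq_diagMap {φ : Map 2} (h : IsQPositive φ) (h1 : φ 1 = 1)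
    {A : Mat 2} {d : Fin 2 → ℂ} (hA : φ A = diagonal d) (hd : d 0 ≠ d 1) :
    IsUnit φ ∨ ∃ C, φ = diagMap C := by
  have h_dom := h.qDominates_self
  obtain ⟨L, hL⟩ := h_dom.exists_isResolventLimit h1
  have hL_apply (B : Mat 2) : L (φ B) = φ B :=
    LinearMap.congr_fun (hL.mul_eq_right h_dom h1) B
  have hL_single {i j : Fin 2} (hij : d i ≠ d j) : L (single i i 1) = single i i 1 := by
    have h_single : single i i 1 = φ ((d i - d j)⁻¹ • (A - d j • 1)) := by
      rw [map_smul, map_sub, map_smul, hA, h1]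
      ext k l
      fin_cases i <;> fin_cases j <;> fin_cases k <;> fin_cases l <;>
        simp_all [sub_ne_zero]
    rw [h_single, hL_apply]
  rcases (hL.isCP h).eq_one_or_eq_diagMap_one (hL.mul_self h_dom h1)
    (Fin.forall_fin_two.mpr ⟨hL_single hd, hL_single hd.symm⟩) with rfl | rfl
  · exact Or.inl (hL.isUnit h)
  · have h_left := hL.mul_eq_right h_dom h1
    have h_right := hL.mul_eq_left h_dom h1
    exact Or.inr ⟨_, eq_diagMap_of_mul_diagMap_one h_left h_right⟩

lemma IsQPure.isUnit_of_map_eq_diagonal {φ : Map 2} (h : IsQPure φ) (h1 : φ 1 = 1)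
    {A : Mat 2} {d : Fin 2 → ℂ} (hA : φ A = diagonal d) (hd : d 0 ≠ d 1) : IsUnit φ := by
  refine (h.1.isUnit_or_eq_diagMap h1 hA hd).resolve_right ?_
  rintro ⟨C, rfl⟩
  obtain ⟨a, b, ha, hb, rfl⟩ := exists_eq_twoStateMatrix h.1.isCP h1
  refine not_isQPure_diagMap_twoStateMatrix ha hb (fun hab => hd ?_) h
  have hab' : (b : ℂ) = 1 - a := by exact_mod_cast eq_sub_of_add_eq' hab
  rw [diagMap_apply, diagonal_eq_diagonal_iff] at hA
  rw [← hA, ← hA]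
  simp [twoStateMatrix, mulVec, dotProduct, hab']

lemma IsQPure.isUnit_or_map_mem_span_one {φ : Map 2} (h : IsQPure φ) (h1 : φ 1 = 1) {A : Mat 2}
    (hA : (φ A).IsHermitian) : IsUnit φ ∨ φ A ∈ ℂ ∙ (1 : Mat 2) := by
  obtain ⟨U, d, hd⟩ := exists_eq_unitaryConj_diagonal hA
  obtain hd_eq | hd_ne := eq_or_ne (d 0) (d 1)
  · right
    have h_scalar : (diagonal fun i => (d i : ℂ)) = (d 0 : ℂ) • (1 : Mat 2) := by
      rw [smul_one_eq_diagonal]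
      congr 1 with i
      fin_cases i <;> simp [hd_eq]
    rw [hd, h_scalar, map_smul, unitaryConj_apply_one]
    exact Submodule.smul_mem _ _ (Submodule.mem_span_singleton_self _)
  · left
    set ψ : Map 2 := unitaryConj U⁻¹ * φ * ↑(unitaryConj U⁻¹)⁻¹ with hψ_def
    have hψ : IsQPure ψ := (isConjugateTo_iff.mpr ⟨U⁻¹, hψ_def⟩).isQPure h
    have hψ_one : ψ 1 = 1 := by
      rw [hψ_def, ← map_inv, inv_inv, Module.End.mul_apply, Module.End.mul_apply,
        unitaryConj_apply_one, h1, unitaryConj_apply_one]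
    have hψ_map : ψ ((unitaryConj U⁻¹ : Map 2) A) = diagonal fun i => (d i : ℂ) := by
      rw [hψ_def, map_inv, inv_inv, ← Module.End.mul_apply, Units.mul_inv_cancel_right,
        Module.End.mul_apply, hd, ← Module.End.mul_apply, Units.inv_mul, Module.End.one_apply]
    have hψ_unit : IsUnit ψ :=
      hψ.isUnit_of_map_eq_diagonal hψ_one hψ_map (by exact_mod_cast hd_ne)
    rwa [hψ_def, Units.isUnit_mul_units, Units.isUnit_units_mul] at hψ_unit

lemma exists_eq_smulRight_of_range_le {φ : Map n} {B : Mat n} (hB : B ≠ 0)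
    (h : LinearMap.range φ ≤ ℂ ∙ B) : ∃ ρ : Mat n →ₗ[ℂ] ℂ, φ = ρ.smulRight B :=
  ⟨LinearEquiv.coord ℂ (Mat n) B hB ∘ₗ φ.codRestrict (ℂ ∙ B) fun A => h ⟨A, rfl⟩,
    LinearMap.ext fun A => (LinearEquiv.coord_apply_smul ℂ (Mat n) B hB ⟨φ A, h ⟨A, rfl⟩⟩).symm⟩

open scoped ComplexStarModule in
lemma range_le_of_forall_isHermitian {φ : Map n} {p : Submodule ℂ (Mat n)}
    (h : ∀ A : Mat n, A.IsHermitian → φ A ∈ p) : LinearMap.range φ ≤ p := by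
  rintro _ ⟨A, rfl⟩
  rw [← realPart_add_I_smul_imaginaryPart A, map_add, map_smul]
  exact p.add_mem (h _ (ℜ A).2) (p.smul_mem _ (h _ (ℑ A).2))

theorem IsQPure.isUnit_or_exists_eq_smulRight {φ : Map 2} (h : IsQPure φ) (h1 : φ 1 = 1) :
    IsUnit φ ∨ ∃ ρ : Mat 2 →ₗ[ℂ] ℂ, φ = ρ.smulRight 1 := by
  refine or_iff_not_imp_left.mpr fun h_unit => exists_eq_smulRight_of_range_le one_ne_zero
    (range_le_of_forall_isHermitian fun A hA => (h.isUnit_or_map_mem_span_one h1 ?_).resolve_left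
      h_unit)
  rw [IsHermitian, ← star_eq_conjTranspose, ← h.1.isCP.map_star, star_eq_conjTranspose, hA.eq]

end Dichotomy

end QPos

end

theorem mainTheorem1 (φ : QPos.Map 2) (hφ : φ 1 = 1) :
    (QPos.IsQPure φ ↔
      (∃ ρ : QPos.Mat 2 →ₗ[ℂ] ℂ, QPos.IsFaithfulState ρ ∧
        ∀ A : QPos.Mat 2, φ A = ρ A • (1 : QPos.Mat 2)) ∨
      (∃ l : ℝ, QPos.IsConjugateTo φ
        (QPos.schurMap
          !![1, 1 / (1 + Complex.I * (l : ℂ)); 1 / (1 - Complex.I * (l : ℂ)), 1]))) ∧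
    (QPos.IsQPure φ →
      Module.finrank ℂ (LinearMap.range φ) = 1 ∨ Function.Bijective φ) := by
  refine ⟨⟨fun h => ?_, ?_⟩, fun h => ?_⟩
  · rcases h.isUnit_or_exists_eq_smulRight hφ with ⟨φ, rfl⟩ | ⟨ρ, rfl⟩
    · obtain ⟨d, hd⟩ := h.exists_isConjugateTo_phaseMatrix hφ
      exact Or.inr ⟨d 0 - d 1, QPos.phaseMatrix_fin_two d ▸ hd⟩
    · have hρ : ρ 1 = 1 := by simpa using congrFun (congrFun hφ 0) 0
      exact Or.inl ⟨ρ, h.isFaithfulState hρ, fun A => rfl⟩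
  · rintro (⟨ρ, hρ, h⟩ | ⟨l, hl⟩)
    · rw [show φ = ρ.smulRight 1 from LinearMap.ext h]
      exact QPos.isQPure_smulRight hρ
    · refine hl.isQPure ?_
      simpa [QPos.phaseMatrix_fin_two] using QPos.isQPure_schurMap_phaseMatrix ![l, 0]
  · rcases h.isUnit_or_exists_eq_smulRight hφ with h_unit | ⟨ρ, rfl⟩
    · exact Or.inr ((Module.End.isUnit_iff φ).mp h_unit)
    · left
      have hρ : ρ ≠ 0 := by
        rintro rfl
        simp at hφ
      rw [LinearMap.range_smulRight_apply hρ, finrank_span_singleton one_ne_zero]
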